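/- Let $\zeta=e^{2\pi i/5}$, $\tau=\frac{1+\sqrt5}{2}$ and $K=\mathbb{Q}(\sqrt5)$, with Dedekind zeta function $\zeta_K$. Let $\sigma$ be the automorphism of $\mathbb{Q}(\zeta)$ with $\sigma(\zeta)=\zeta^2$, and let $\kappa:\mathbb{Z}[\zeta]\to\mathbb{Z}/5\mathbb{Z}$ be the ring homomorphism with $\kappa(\zeta)=1$. Let $\mathcal{W}_1\subset\mathbb{C}$ be the interior of the convex hull of $\{1,\zeta,\zeta^2,\zeta^3,\zeta^4\}$. For $\epsilon\in\mathbb{C}$ put $\mathcal{W}_{1,\epsilon}=\mathcal{W}_1+\epsilon$, $\mathcal{W}_{2,\epsilon}=-\tau\mathcal{W}_1+\epsilon$, $\mathcal{W}_{3,\epsilon}=\tau\mathcal{W}_1+\epsilon$, $\mathcal{W}_{4,\epsilon}=-\mathcal{W}_1+\epsilon$, and $$\mathcal{P}_\epsilon=\bigcup_{k=1}^4\{x\in\mathbb{Z}[\zeta] : \kappa(x)=k,\ \sigma(x)\in\mathcal{W}_{k,\epsilon}\}\subset\mathbb{C}=\mathbb{R}^2 .$$ For $\mathcal{P}\subset\mathbb{C}$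 let $\widehat{\mathcal{P}}=\{x\in\mathcal{P} : tx\notin\mathcal{P}\text{ for all }t\in(0,1)\}$ be the set of points of $\mathcal{P}$ visible from the origin. A locally finite set $\mathcal{Q}\subset\mathbb{C}$ has density $\theta(\mathcal{Q})$ if $\lim_{T\to\infty}\frac{\#(\mathcal{Q}\cap TD)}{\mathrm{vol}(TD)}=\theta(\mathcal{Q})$ for every Jordan measurable $D\subset\mathbb{C}$ with $\mathrm{vol}(D)>0$. **Theorem.** For every $\epsilon\in\mathbb{C}$ with $|\epsilon|<0.1$, the set $\widehat{\mathcal{P}_\epsilon}$ is locally finite, its density exists, and $$\theta(\widehat{\mathcal{P}_\epsilon})=\frac{(3+\tau)\,\mathrm{vol}(\mathcal{W}_1)-\mathrm{vol}\big(\mathcal{W}_1\cap(\mathcal{W}_1+\tau\epsilon)\big)}{3(\tau+2)\,\zeta_K(2)} .$$ -/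

import Mathlib

open MeasureTheory Filter Topology Polynomial
open scoped Pointwise IntermediateField

noncomputable section

namespace PenroseVisible

/-! ### Visible points and asymptotic density in the plane `ℂ = ℝ²` -/

/-- The subset of the points of `P` that are visible from the origin. -/
def visible (P : Set ℂ) : Set ℂ :=
  {x ∈ P | ∀ t : ℝ, 0 < t → t < 1 → (t : ℂ) * x ∉ P}

/-- A point set is locally finite if every bounded region contains finitely many of its points. -/
def LocFinite (P : Set ℂ) : Prop :=
  ∀ B : Set ℂ, Bornology.IsBounded B → (P ∩ B).Finite

/-- Jordan measurable sets: bounded sets whose boundary has Lebesgue measure zero. -/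
def JordanMeasurable (D : Set ℂ) : Prop :=
  Bornology.IsBounded D ∧ volume (frontier D) = 0

/-- `P` is locally finite and has asymptotic density `θ`: for every Jordan measurable `D` of
positive area, `#(P ∩ T D) / vol(T D) → θ` as `T → ∞`. -/
def HasDensity (P : Set ℂ) (θ : ℝ) : Prop :=
  LocFinite P ∧
    ∀ D : Set ℂ, JordanMeasurable D → 0 < volume D →
      Tendsto (fun T : ℝ => ((P ∩ T • D).ncard : ℝ) / (volume (T • D)).toReal) atTop (𝓝 θ)

/-! ### The ring `ℤ[ζ]`, `ζ = exp(2πi/5)`, and its homomorphisms `σ` and `κ` -/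

/-- `ζ = exp(2πi/5)`. -/
def zeta5 : ℂ := Complex.exp (2 * Real.pi * Complex.I / (5 : ℕ))

theorem zeta5_isPrimitiveRoot : IsPrimitiveRoot zeta5 5 :=
  Complex.isPrimitiveRoot_exp 5 (by norm_num)

theorem zeta5_isIntegral : IsIntegral ℤ zeta5 :=
  zeta5_isPrimitiveRoot.isIntegral (by norm_num)

/-- The subring `ℤ[ζ]` of `ℂ`. -/
abbrev ZZeta : Subalgebra ℤ ℂ := Algebra.adjoin ℤ {zeta5}

/-- `ζ` as an element of `ℤ[ζ]`. -/
def zetaGen : ZZeta := ⟨zeta5, Algebra.subset_adjoin (Set.mem_singleton zeta5)⟩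

/-- The power basis `1, ζ, ζ², ζ³` of `ℤ[ζ]`. -/
def zetaBasis : PowerBasis ℤ ZZeta := Algebra.adjoin.powerBasis' zeta5_isIntegral

theorem zetaBasis_gen : zetaBasis.gen = zetaGen :=
  Algebra.adjoin.powerBasis'_gen zeta5_isIntegral

theorem minpoly_zetaBasis_gen : minpoly ℤ zetaBasis.gen = cyclotomic 5 ℤ := by
  rw [cyclotomic_eq_minpoly zeta5_isPrimitiveRoot (by norm_num), zetaBasis_gen]
  exact (minpoly.algebraMap_eq (B := ZZeta) (B' := ℂ) Subtype.val_injective zetaGen).symm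

theorem aeval_cyclotomic_five {R : Type*} [CommRing R] (x : R) :
    aeval x (cyclotomic 5 ℤ) = 1 + x + x ^ 2 + x ^ 3 + x ^ 4 := by
  have : Fact (Nat.Prime 5) := ⟨by norm_num⟩
  rw [cyclotomic_prime]
  simp [Finset.sum_range_succ]

/-- The embedding `σ : ℤ[ζ] → ℂ` determined by `σ(ζ) = ζ²`, that is, the restriction to `ℤ[ζ]`
of the field automorphism `ζ ↦ ζ²` of `ℚ(ζ)`. -/
def sigma : ZZeta →ₐ[ℤ] ℂ :=
  zetaBasis.lift (zeta5 ^ 2) (by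
    rw [minpoly_zetaBasis_gen]
    have h : IsPrimitiveRoot (zeta5 ^ 2) 5 :=
      zeta5_isPrimitiveRoot.pow_of_coprime 2 (by norm_num)
    rw [cyclotomic_eq_minpoly h (by norm_num)]
    exact minpoly.aeval ℤ (zeta5 ^ 2))

theorem sigma_zetaGen : sigma zetaGen = zeta5 ^ 2 := by
  rw [← zetaBasis_gen]
  exact zetaBasis.lift_gen _ _

/-- The ring homomorphism `κ : ℤ[ζ] → ℤ/5ℤ` determined by `κ(ζ) = 1`. -/
def kappa : ZZeta →ₐ[ℤ] ZMod 5 :=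
  zetaBasis.lift 1 (by
    rw [minpoly_zetaBasis_gen, aeval_cyclotomic_five]
    decide)

theorem kappa_zetaGen : kappa zetaGen = 1 := by
  rw [← zetaBasis_gen]
  exact zetaBasis.lift_gen _ _

/-! ### The windows and the `𝒫`-sets -/

/-- The golden ratio `τ = (1 + √5) / 2`. -/
abbrev tau : ℝ := Real.goldenRatio

/-- The open regular pentagon `𝒲₁` with vertices `1, ζ, ζ², ζ³, ζ⁴`. -/
def pentagon : Set ℂ :=
  interior (convexHull ℝ {1, zeta5, zeta5 ^ 2, zeta5 ^ 3, zeta5 ^ 4})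

/-- The factors `1, -τ, τ, -1` by which `𝒲₁` is scaled for `k = 1, 2, 3, 4`
(the value at other `k` is never used). -/
def windowScale : ℕ → ℝ
  | 1 => 1
  | 2 => -tau
  | 3 => tau
  | 4 => -1
  | _ => 0

/-- The window `𝒲_{k,ε} = windowScale k · 𝒲₁ + ε`. -/
def window (k : ℕ) (ε : ℂ) : Set ℂ :=
  (fun w : ℂ => (windowScale k : ℂ) * w + ε) '' pentagon

/-- `Λ_{k,ε} = {x ∈ ℤ[ζ] | κ(x) = k, σ(x) ∈ 𝒲_{k,ε}}`, as a set of points of the plane. -/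
def lambdaSet (k : ℕ) (ε : ℂ) : Set ℂ :=
  {z : ℂ | ∃ x : ZZeta, (x : ℂ) = z ∧ kappa x = (k : ZMod 5) ∧ sigma x ∈ window k ε}

/-- The set `𝒫_ε = Λ_{1,ε} ∪ Λ_{2,ε} ∪ Λ_{3,ε} ∪ Λ_{4,ε}`. -/
def penroseSet (ε : ℂ) : Set ℂ := ⋃ k ∈ Finset.Icc 1 4, lambdaSet k ε

/-! ### The field `ℚ(√5)` -/

/-- The field `K = ℚ(√5) ⊆ ℝ`. -/
abbrev QSqrtFive : IntermediateField ℚ ℝ := ℚ⟮(√5 : ℝ)⟯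

theorem sqrtFive_isIntegral : IsIntegral ℚ (√5 : ℝ) := by
  refine ⟨X ^ 2 - C 5, monic_X_pow_sub_C 5 (by norm_num), ?_⟩
  simp

instance QSqrtFive.instNumberField : NumberField QSqrtFive where
  to_charZero := inferInstance
  to_finiteDimensional := IntermediateField.adjoin.finiteDimensional sqrtFive_isIntegral

end PenroseVisible

end

noncomputable section

namespace PenroseVisible

/-! ### The ring `ℤ[τ]` -/

/-! The ring `ℤ[ζ]` is free over `ℤ[τ]` with basis `1, ζ`, so its elements are pairs of golden
integers, with maps `phys`, `intl`, `res` standing for the inclusion, `σ` and `κ`. A prime denotes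
conjugation `τ ↦ 1 - τ`.

Visibility is settled by arithmetic in `ℤ[τ]`. Every window contains the disc of radius 0.7 and lies
in the disc of radius 1.7181 about 0. If the coordinates of `x` have a nonunit common divisor, its
norm is at least 4 in absolute value, and replacing that divisor by a suitable power of `τ` gives a
point of `𝒫_ε` on the same ray closer to the origin; so visible points are primitive. For primitive
`x`, Bézout shows that `t x ∈ ℤ[ζ]` forces `t ∈ ℤ[τ]`. An element of `ℤ[τ]` in `(0, 1)` is `1/τ`,
`1/τ²`, or has so large a conjugate that `x/τ` already hides `x`. Hence visibility means primitivity
together with `σ(x)` in the reduced window `visWin` (`visible_penroseSet`).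

Primitive points are counted by Möbius inversion over the ideals of the principal ideal domain
`ℤ[τ]` (`ncard_primitive_eq_tsum`). For `d` prime to `√5`, the multiples of `d` in a given nonzero
residue class have density `vol(W) · 4/(25√5) / N(d)²` (`tendsto_ncard_region_dvd`); multiples of
`√5` have residue 0 and do not occur. The bound `exists_region_bound` is summable over ideals, so
the limit passes through the sum (`tendsto_ncard_primitive`), and the Möbius sum without the Euler
factor at `√5` is `(25/24)/ζ_K(2)`.

The areas of the four reduced windows add up to `(2/τ)((3 + τ) vol(𝒲₁) - vol(𝒲₁ ∩ (𝒲₁ + τε)))`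
(`sum_measureReal_visWin`), and `τ√5 = τ + 2` gives the stated constant. -/

/-- The ring `ℤ[τ]`, presented as `ℤ[ω]` with `ω² = 1 + ω`. -/
abbrev GoldenInt : Type := QuadraticAlgebra ℤ 1 1

namespace GoldenInt

/-- The embedding `ω ↦ τ` of `ℤ[τ]` into `ℝ`. -/
def toReal : GoldenInt →ₐ[ℤ] ℝ :=
  QuadraticAlgebra.lift ⟨Real.goldenRatio, by
    have h := Real.goldenRatio_sq
    rw [one_smul, one_smul, ← sq, h, add_comm]⟩

/-- The embedding `ω ↦ 1 - τ` of `ℤ[τ]` into `ℝ`. -/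
def conj : GoldenInt →ₐ[ℤ] ℝ :=
  QuadraticAlgebra.lift ⟨Real.goldenConj, by
    have h := Real.goldenConj_sq
    rw [one_smul, one_smul, ← sq, h, add_comm]⟩

/-- Reduction of `ℤ[τ]` modulo `√5`. -/
def mod5 : GoldenInt →ₐ[ℤ] ZMod 5 :=
  QuadraticAlgebra.lift ⟨3, by decide⟩

theorem toReal_apply (a : GoldenInt) : toReal a = a.re + a.im * Real.goldenRatio := by
  simp [toReal]

theorem conj_apply (a : GoldenInt) : conj a = a.re + a.im * Real.goldenConj := by
  simp [conj]

theorem mod5_apply (a : GoldenInt) : mod5 a = a.re + a.im * 3 := by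
  simp [mod5]

theorem conj_eq (a : GoldenInt) : conj a = a.re + a.im * (1 - Real.goldenRatio) := by
  rw [conj_apply, Real.one_sub_goldenConj]

theorem toReal_sub_conj (a : GoldenInt) : toReal a - conj a = a.im * √5 := by
  rw [toReal_apply, conj_apply, ← Real.goldenRatio_sub_goldenConj]; ring

theorem toReal_add_conj (a : GoldenInt) : toReal a + conj a = 2 * a.re + a.im := by
  rw [toReal_apply, conj_eq]; ring

theorem toReal_injective : Function.Injective toReal := by
  rw [injective_iff_map_eq_zero]
  intro a ha
  rw [toReal_apply] at ha
  by_cases h : a.im = 0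
  · ext
    · simpa [h] using ha
    · exact h
  · exfalso
    have := (Real.goldenRatio_irrational.intCast_mul h).intCast_add a.re
    rw [ha] at this
    exact this.ne_zero rfl

theorem conj_injective : Function.Injective conj := by
  rw [injective_iff_map_eq_zero]
  intro a ha
  rw [conj_apply] at ha
  by_cases h : a.im = 0
  · ext
    · simpa [h] using ha
    · exact h
  · exfalso
    have := (Real.goldenConj_irrational.intCast_mul h).intCast_add a.re
    rw [ha] at this
    exact this.ne_zero rfl

instance : IsDomain GoldenInt :=
  toReal_injective.isDomain toReal.toRingHom

theorem toReal_mul_conj (a : GoldenInt) : toReal a * conj a = a.norm := by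
  rw [toReal_apply, conj_eq, QuadraticAlgebra.norm_def]
  push_cast
  linear_combination (- a.im ^ 2 : ℝ) * Real.goldenRatio_sq

theorem norm_eq_zero {a : GoldenInt} : a.norm = 0 ↔ a = 0 := by
  rw [← Int.cast_inj (α := ℝ), ← toReal_mul_conj, Int.cast_zero, mul_eq_zero,
    map_eq_zero_iff _ toReal_injective, map_eq_zero_iff _ conj_injective, or_self]

/-- Norm-Euclidean division: rounding the coordinates of `y / x` leaves an error `s + tω` with `|s|,
|t| ≤ 1/2`, and then `|s² + st - t²| < 1`. -/
theorem exists_norm_sub_mul_lt (x y : GoldenInt) (hx : x ≠ 0) :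
    ∃ c : GoldenInt, |(y - x * c).norm| < |x.norm| := by
  have hN : x.norm ≠ 0 := mt norm_eq_zero.1 hx
  have hr : ∀ A : ℤ, ∃ m : ℤ, 2 * |A - x.norm * m| ≤ |x.norm| := fun A => by
    refine ⟨round ((A : ℚ) / x.norm), ?_⟩
    have h := abs_sub_round ((A : ℚ) / x.norm)
    have hN' : (x.norm : ℚ) ≠ 0 := by exact_mod_cast hN
    have h2 : |((A - x.norm * round ((A : ℚ) / x.norm) : ℤ) : ℚ)|
        = |(x.norm : ℚ)| * |(A : ℚ) / x.norm - round ((A : ℚ) / x.norm)| := by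
      rw [← abs_mul]; push_cast; congr 1; field_simp
    have h3 : (2 * |((A - x.norm * round ((A : ℚ) / x.norm) : ℤ) : ℚ)|) ≤ |(x.norm : ℚ)| := by
      rw [h2]; nlinarith [abs_nonneg (x.norm : ℚ)]
    exact_mod_cast h3
  obtain ⟨m, hm⟩ := hr (y * star x).re
  obtain ⟨n, hn⟩ := hr (y * star x).im
  refine ⟨⟨m, n⟩, ?_⟩
  have key : (y - x * ⟨m, n⟩).norm * x.norm
      = ((y * star x).re - x.norm * m) ^ 2
        + ((y * star x).re - x.norm * m) * ((y * star x).im - x.norm * n)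
        - ((y * star x).im - x.norm * n) ^ 2 := by
    simp only [QuadraticAlgebra.norm_def, QuadraticAlgebra.re_mul, QuadraticAlgebra.im_mul,
      QuadraticAlgebra.re_sub, QuadraticAlgebra.im_sub, QuadraticAlgebra.re_star,
      QuadraticAlgebra.im_star]
    ring
  set s := (y * star x).re - x.norm * m
  set t := (y * star x).im - x.norm * n
  have hpos : 0 < |x.norm| := abs_pos.2 hN
  have h1 : |(y - x * ⟨m, n⟩).norm| * |x.norm| < |x.norm| * |x.norm| := by
    rw [← abs_mul, key, abs_lt]
    have hs := abs_nonneg s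
    have ht := abs_nonneg t
    have hs2 := sq_abs s
    have ht2 := sq_abs t
    have hst : |s * t| = |s| * |t| := abs_mul s t
    have h4 := abs_le.1 hst.le
    constructor <;> nlinarith
  exact lt_of_mul_lt_mul_right h1 hpos.le

instance : IsPrincipalIdealRing GoldenInt where
  principal I := by
    by_cases hI : I = ⊥
    · exact ⟨⟨0, by simp [hI]⟩⟩
    obtain ⟨x₀, hx₀, hx₀'⟩ := Submodule.exists_mem_ne_zero_of_ne_bot hI
    let s : Set GoldenInt := {x | x ∈ I ∧ x ≠ 0}
    have hs : s.Nonempty := ⟨x₀, hx₀, hx₀'⟩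
    let f : GoldenInt → ℕ := fun x => x.norm.natAbs
    have hmem := Function.argminOn_mem f s hs
    set g := Function.argminOn f s hs
    refine ⟨⟨g, le_antisymm (fun y hy => ?_) ?_⟩⟩
    · obtain ⟨c, hc⟩ := exists_norm_sub_mul_lt g y hmem.2
      have hr : y - g * c ∈ I := I.sub_mem hy (I.mul_mem_right _ hmem.1)
      have h0 : y - g * c = 0 := by
        by_contra h
        have := Function.argminOn_le f s (a := y - g * c) ⟨hr, h⟩
        change f g ≤ f (y - g * c) at this
        have h2 : f (y - g * c) < f g := by
          rw [Int.abs_eq_natAbs, Int.abs_eq_natAbs] at hc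
          exact_mod_cast hc
        omega
      rw [sub_eq_zero.1 h0]
      exact Ideal.mul_mem_right _ _ (Ideal.mem_span_singleton_self g)
    · exact (Ideal.span_singleton_le_iff_mem I).2 hmem.1

theorem absNorm_span_singleton (d : GoldenInt) :
    (Ideal.absNorm (Ideal.span {d}) : ℝ) = |toReal d * conj d| := by
  rw [Ideal.absNorm_span_singleton, toReal_mul_conj]
  have : Algebra.norm ℤ d = d.norm := by
    rw [Algebra.norm_apply, ← QuadraticAlgebra.det_toLinearMap_eq_norm]
    congr 1
  rw [this, ← Int.cast_abs, Int.abs_eq_natAbs]; simp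

/-- The fundamental unit `τ`. -/
def tauUnit : GoldenIntˣ where
  val := ⟨0, 1⟩
  inv := ⟨-1, 1⟩
  val_inv := by ext <;> simp [QuadraticAlgebra.re_one, QuadraticAlgebra.im_one]
  inv_val := by ext <;> simp [QuadraticAlgebra.re_one, QuadraticAlgebra.im_one]

theorem toReal_tauUnit_zpow (n : ℤ) :
    toReal ((tauUnit ^ n : GoldenIntˣ) : GoldenInt) = Real.goldenRatio ^ n := by
  have h : ((Units.map (toReal : GoldenInt →* ℝ) tauUnit : ℝˣ) : ℝ) = Real.goldenRatio := by
    simp [tauUnit, toReal_apply]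
  rw [← h, ← Units.val_zpow_eq_zpow_val, ← map_zpow]
  rfl

theorem conj_tauUnit_zpow (n : ℤ) :
    conj ((tauUnit ^ n : GoldenIntˣ) : GoldenInt) = Real.goldenConj ^ n := by
  have h : ((Units.map (conj : GoldenInt →* ℝ) tauUnit : ℝˣ) : ℝ) = Real.goldenConj := by
    simp [tauUnit, conj_apply]
  rw [← h, ← Units.val_zpow_eq_zpow_val, ← map_zpow]
  rfl

theorem abs_conj_tauUnit_zpow (n : ℤ) :
    |conj ((tauUnit ^ n : GoldenIntˣ) : GoldenInt)| = (Real.goldenRatio ^ n)⁻¹ := by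
  rw [conj_tauUnit_zpow, abs_zpow, abs_of_neg Real.goldenConj_neg, ← Real.inv_goldenRatio, inv_zpow]

theorem mod5_tauUnit_pow_four (n : ℕ) :
    mod5 ((tauUnit ^ (4 * n) : GoldenIntˣ) : GoldenInt) = 1 := by
  have h : mod5 (tauUnit : GoldenInt) = 3 := by simp [tauUnit, mod5_apply]
  have h4 : (3 : ZMod 5) ^ 4 = 1 := by decide
  rw [Units.val_pow_eq_pow_val, map_pow, h, pow_mul, h4, one_pow]

/-- An element of `ℤ[τ]` in `(0, 1)` is `1/τ`, `1/τ²`, or has a large conjugate. -/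
theorem eq_or_le_abs_conj {t : GoldenInt} (h0 : 0 < toReal t) (h1 : toReal t < 1) :
    t = ⟨-1, 1⟩ ∨ t = ⟨2, -1⟩ ∨ 4.236 ≤ |conj t| := by
  have h5 : (2.236 : ℝ) < √5 := by
    rw [Real.lt_sqrt (by norm_num)]; norm_num
  have h5' : √5 < (2.2361 : ℝ) := by
    rw [Real.sqrt_lt' (by norm_num)]; norm_num
  have hd := toReal_sub_conj t
  have hs := toReal_add_conj t
  set b := t.im with hb
  set a := t.re with ha
  -- Since `t - t' = b√5` with `0 < t < 1`, a large `b` forces a large conjugate; only `|b| ≤ 2`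
  -- needs inspection.
  have hlarge : ∀ x : ℝ, x * √5 = toReal t - conj t → 3 ≤ |x| → 4.236 ≤ |conj t| := by
    intro x hx hx3
    have : |x * √5| ≤ |toReal t| + |conj t| := by rw [hx]; exact abs_sub _ _
    rw [abs_mul, abs_of_pos h0, abs_of_pos (by linarith : (0:ℝ) < √5)] at this
    nlinarith
  by_cases hb3 : 3 ≤ |b|
  · right; right
    exact hlarge b hd.symm (by exact_mod_cast hb3)
  have hb3' := abs_lt.1 (not_le.1 hb3)
  have hcast : ∀ z w : ℤ, (z : ℝ) < w → z < w := fun z w h => by exact_mod_cast h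
  have hT : 2 * toReal t = 2 * a + b + b * √5 := by linarith
  obtain ⟨hl, hr⟩ := hb3'
  have hbc : b = -2 ∨ b = -1 ∨ b = 0 ∨ b = 1 ∨ b = 2 := by omega
  rcases hbc with h | h | h | h | h <;> rw [h] at hT hd <;> push_cast at hT hd
  · right; right; rw [le_abs]; left; linarith
  · have h2 : (1:ℤ) < a := hcast _ _ (by push_cast; linarith)
    have h3 : a < (3:ℤ) := hcast _ _ (by push_cast; linarith)
    right; left
    ext
    · change a = 2; omega
    · change b = -1; omega
  · have h2 : (0:ℤ) < a := hcast _ _ (by push_cast; linarith)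
    have h3 : a < (1:ℤ) := hcast _ _ (by push_cast; linarith)
    omega
  · have h2 : (-2:ℤ) < a := hcast _ _ (by push_cast; linarith)
    have h3 : a < (0:ℤ) := hcast _ _ (by push_cast; linarith)
    left
    ext
    · change a = -1; omega
    · change b = 1; omega
  -- Here `t = 2τ - 3 = τ⁻³` and `t' = -τ³ = -(2 + √5)`: the extremal case that dictates the
  -- constant 4.236.
  · have h2 : (-4:ℤ) < a := hcast _ _ (by push_cast; linarith)
    have h3 : a < (-2:ℤ) := hcast _ _ (by push_cast; linarith)
    have h4 : a = -3 := by omega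
    rw [h4, h] at hs
    push_cast at hs
    right; right; rw [le_abs]; right; linarith

end GoldenInt

end PenroseVisible

namespace PenroseVisible

/-! ### The Dedekind zeta function at `2` as a sum over ideals -/

section Zeta

open NumberField

variable (K : Type*) [Field K] [NumberField K]

/-- The ideal counting theorem gives linear growth, which makes the Dirichlet series of `ζ_K`
converge absolutely at 2. -/
theorem sum_card_absNorm_eq_isBigO :
    (fun n : ℕ => ∑ k ∈ Finset.Icc 1 n, (Nat.card {I : Ideal (𝓞 K) // Ideal.absNorm I = k} : ℝ))
      =O[atTop] fun n : ℕ => (n : ℝ) ^ (1 : ℝ) := by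
  have h1 : (fun n : ℕ => (Nat.card {I : Ideal (𝓞 K) // (Ideal.absNorm I : ℝ) ≤ (n : ℝ)} : ℝ))
      =O[atTop] fun n : ℕ => (n : ℝ) := by
    have h := ((NumberField.Ideal.tendsto_norm_le_div_atTop K).comp
      tendsto_natCast_atTop_atTop).isBigO_one ℝ
    have h2 := h.mul (Asymptotics.isBigO_refl (fun n : ℕ => (n : ℝ)) atTop)
    refine (h2.congr' ?_ ?_)
    · filter_upwards [eventually_gt_atTop 0] with n hn
      have : (n : ℝ) ≠ 0 := by positivity
      simp only [Function.comp_apply]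
      field_simp
    · filter_upwards with n; simp
  refine Asymptotics.IsBigO.trans (Asymptotics.IsBigO.of_norm_le fun n => ?_)
    (h1.congr_right fun n => by simp)
  rw [← Nat.cast_sum, ← Finset.card_preimage_eq_sum_card_image_eq
    (fun k _ => Ideal.finite_setOfPred_absNorm_eq k), Real.norm_natCast, Nat.cast_le]
  have hfin : {I : Ideal (𝓞 K) | (Ideal.absNorm I : ℝ) ≤ (n : ℝ)}.Finite := by
    simpa using Ideal.finite_setOfPred_absNorm_le (S := 𝓞 K) n
  refine Nat.card_mono hfin fun I hI => ?_
  simp only [Set.mem_preimage, SetLike.mem_coe, Finset.mem_Icc] at hI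
  change (Ideal.absNorm I : ℝ) ≤ n
  exact_mod_cast hI.2

theorem summable_card_absNorm_div_sq :
    Summable fun n : ℕ =>
      (Nat.card {I : Ideal (𝓞 K) // Ideal.absNorm I = n} : ℝ) * ((n : ℝ) ^ 2)⁻¹ := by
  have h := LSeriesSummable_of_sum_norm_bigO_and_nonneg (s := 2) (sum_card_absNorm_eq_isBigO K)
    (fun n => Nat.cast_nonneg _) zero_le_one (by simp)
  have h2 := h.norm
  refine h2.congr fun n => ?_
  rw [LSeries.term_def]
  split_ifs with hn
  · simp [hn]
  · simp [div_eq_mul_inv]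

theorem summable_absNorm_sq_inv :
    Summable fun I : Ideal (𝓞 K) => ((Ideal.absNorm I : ℝ) ^ 2)⁻¹ := by
  rw [← (Equiv.sigmaFiberEquiv (Ideal.absNorm : Ideal (𝓞 K) → ℕ)).summable_iff,
    summable_sigma_of_nonneg (fun x => by simp only [Function.comp_apply]; positivity)]
  have key : ∀ n : ℕ, ∀ I : {I : Ideal (𝓞 K) // Ideal.absNorm I = n},
      ((fun I : Ideal (𝓞 K) => ((Ideal.absNorm I : ℝ) ^ 2)⁻¹) ∘
        (Equiv.sigmaFiberEquiv (Ideal.absNorm : Ideal (𝓞 K) → ℕ))) ⟨n, I⟩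
      = ((n : ℝ) ^ 2)⁻¹ := by
    rintro n ⟨I, rfl⟩; rfl
  have hfin : ∀ n : ℕ, Finite {I : Ideal (𝓞 K) // Ideal.absNorm I = n} :=
    fun n => (Ideal.finite_setOfPred_absNorm_eq n).to_subtype
  refine ⟨fun n => (Summable.of_finite), ?_⟩
  simp_rw [key, tsum_const, nsmul_eq_mul]
  exact summable_card_absNorm_div_sq K

/-- Ideals are grouped by norm. The zero ideal does no harm: its term is `0⁻¹ = 0`, like the term `n
= 0` of the L-series. -/
theorem dedekindZeta_two :
    dedekindZeta K 2 = ((∑' I : Ideal (𝓞 K), ((Ideal.absNorm I : ℝ) ^ 2)⁻¹ : ℝ) : ℂ) := by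
  rw [← (Equiv.sigmaFiberEquiv (Ideal.absNorm : Ideal (𝓞 K) → ℕ)).tsum_eq,
    Summable.tsum_sigma]
  · have key : ∀ n : ℕ, ∀ I : {I : Ideal (𝓞 K) // Ideal.absNorm I = n},
        ((Ideal.absNorm ((Equiv.sigmaFiberEquiv (Ideal.absNorm : Ideal (𝓞 K) → ℕ)) ⟨n, I⟩) : ℝ)
          ^ 2)⁻¹ = ((n : ℝ) ^ 2)⁻¹ := by
      rintro n ⟨I, rfl⟩; rfl
    simp_rw [key, tsum_const, nsmul_eq_mul]
    rw [dedekindZeta, LSeries, Complex.ofReal_tsum]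
    refine tsum_congr fun n => ?_
    rw [LSeries.term_def]
    split_ifs with hn
    · simp [hn]
    · simp [div_eq_mul_inv]
  · exact ((Equiv.sigmaFiberEquiv (Ideal.absNorm : Ideal (𝓞 K) → ℕ)).summable_iff
      (f := fun I => ((Ideal.absNorm I : ℝ) ^ 2)⁻¹)).2 (summable_absNorm_sq_inv K)

end Zeta

/-! ### `ℤ[τ]` as the ring of integers of `ℚ(√5)`, and `ζ_K(2)` over its ideals -/

namespace GoldenInt

/-- The embedding of `ℤ[τ]` into `ℚ(√5)`. -/
def toField : GoldenInt →ₐ[ℤ] QSqrtFive :=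
  QuadraticAlgebra.lift ⟨⟨Real.goldenRatio, by
    have h5 : √5 ∈ QSqrtFive := IntermediateField.mem_adjoin_simple_self ℚ _
    exact div_mem (add_mem (one_mem _) h5) (ofNat_mem _ 2)⟩, by
    have h := Real.goldenRatio_sq
    ext
    push_cast
    rw [one_smul, one_smul, ← sq, h, add_comm]⟩

theorem coe_toField (a : GoldenInt) : (toField a : ℝ) = toReal a := by
  simp [toField, toReal_apply]

theorem exists_eq_div {z : ℝ} (hz : z ∈ QSqrtFive) :
    ∃ x y : GoldenInt, y ≠ 0 ∧ z = toReal x / toReal y := by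
  have hne : ∀ y : GoldenInt, y ≠ 0 → toReal y ≠ 0 := fun y hy =>
    (map_ne_zero_iff _ toReal_injective).2 hy
  induction hz using IntermediateField.adjoin_induction with
  | mem x hx =>
    -- `√5 = 2τ - 1`.
    refine ⟨⟨-1, 2⟩, 1, one_ne_zero, ?_⟩
    rw [Set.mem_singleton_iff.1 hx, map_one, div_one, toReal_apply, Real.goldenRatio]
    push_cast
    ring
  | algebraMap q =>
    have hd : ((q.den : ℕ) : GoldenInt) ≠ 0 := by exact_mod_cast q.den_ne_zero
    refine ⟨(q.num : GoldenInt), (q.den : GoldenInt), hd, ?_⟩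
    simp only [map_intCast, map_natCast, eq_ratCast]
    exact Rat.cast_def q
  | add x y _ _ hx hy =>
    obtain ⟨a, b, hb, rfl⟩ := hx
    obtain ⟨c, d, hd, rfl⟩ := hy
    refine ⟨a * d + b * c, b * d, mul_ne_zero hb hd, ?_⟩
    rw [div_add_div _ _ (hne b hb) (hne d hd)]
    simp
  | inv x _ hx =>
    obtain ⟨a, b, hb, rfl⟩ := hx
    by_cases ha : a = 0
    · exact ⟨0, 1, one_ne_zero, by simp [ha]⟩
    · exact ⟨b, a, ha, by rw [inv_div]⟩
  | mul x y _ _ hx hy =>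
    obtain ⟨a, b, hb, rfl⟩ := hx
    obtain ⟨c, d, hd, rfl⟩ := hy
    exact ⟨a * c, b * d, mul_ne_zero hb hd, by rw [div_mul_div_comm]; simp⟩

instance : Algebra GoldenInt QSqrtFive := toField.toRingHom.toAlgebra

theorem algebraMap_eq (a : GoldenInt) : algebraMap GoldenInt QSqrtFive a = toField a := rfl

instance : FaithfulSMul GoldenInt QSqrtFive := by
  rw [faithfulSMul_iff_algebraMap_injective]
  intro a b h
  apply toReal_injective
  rw [← coe_toField, ← coe_toField, ← algebraMap_eq, ← algebraMap_eq, h]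

instance : IsFractionRing GoldenInt QSqrtFive := by
  refine IsFractionRing.of_field _ _ fun z => ?_
  obtain ⟨x, y, -, h⟩ := exists_eq_div z.2
  refine ⟨x, y, Subtype.ext ?_⟩
  rw [h]
  push_cast
  rw [algebraMap_eq, algebraMap_eq, coe_toField, coe_toField]

/-- `ℤ[τ]` is the ring of integers of `ℚ(√5)`. -/
def ringOfIntegersEquiv : NumberField.RingOfIntegers QSqrtFive ≃+* GoldenInt :=
  -- A principal ideal domain is integrally closed; being integral over `ℤ` with fraction field
  -- `ℚ(√5)`, it is the integral closure of `ℤ` there.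
  haveI : Algebra.IsIntegral ℤ GoldenInt := Algebra.IsIntegral.of_finite ℤ GoldenInt
  haveI : IsIntegralClosure GoldenInt ℤ QSqrtFive :=
    IsIntegralClosure.of_isIntegrallyClosed GoldenInt ℤ QSqrtFive
  NumberField.RingOfIntegers.equiv GoldenInt

theorem absNorm_ringOfIntegersEquiv (I : Ideal GoldenInt) :
    Ideal.absNorm (ringOfIntegersEquiv.idealComapOrderIso I) = Ideal.absNorm I := by
  rw [Ideal.absNorm_apply, Ideal.absNorm_apply, Submodule.cardQuot_apply, Submodule.cardQuot_apply]
  refine Nat.card_congr (Ideal.quotientEquiv _ _ ringOfIntegersEquiv ?_).toEquiv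
  exact (Ideal.map_comap_of_surjective _ ringOfIntegersEquiv.surjective I).symm

/-- The summand `N(I)⁻²` of `ζ_K(2)`. -/
def normInvSq (I : Ideal GoldenInt) : ℝ := ((Ideal.absNorm I : ℝ) ^ 2)⁻¹

theorem summable_normInvSq : Summable normInvSq := by
  rw [← (ringOfIntegersEquiv.idealComapOrderIso.symm.toEquiv).summable_iff]
  refine (summable_absNorm_sq_inv QSqrtFive).congr fun I => ?_
  rw [Function.comp_apply, normInvSq, ← absNorm_ringOfIntegersEquiv]
  simp [Ideal.comap_map_of_bijective _ ringOfIntegersEquiv.bijective]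

theorem dedekindZeta_two_eq :
    NumberField.dedekindZeta QSqrtFive 2 = ((∑' I, normInvSq I : ℝ) : ℂ) := by
  rw [dedekindZeta_two, ← (ringOfIntegersEquiv.idealComapOrderIso.toEquiv).tsum_eq]
  simp_rw [normInvSq]
  congr 1
  refine tsum_congr fun I => ?_
  rw [← absNorm_ringOfIntegersEquiv I]
  rfl

end GoldenInt

/-! ### Möbius inversion -/

section Moebius

open UniqueFactorizationMonoid

theorem abs_moebius_le_one {α : Type*} [CommMonoidWithZero α] [UniqueFactorizationMonoid α]
    (a : α) : |(moebius a : ℝ)| ≤ 1 := by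
  by_cases h : Squarefree a
  · simp [h]
  · simp [h]

open scoped Classical in
theorem moebius_prime_mul {α : Type*} [CommMonoidWithZero α] [UniqueFactorizationMonoid α]
    {p : α} (hp : Prime p) (a : α) :
    moebius (p * a) = if p ∣ a then 0 else - moebius a := by
  split_ifs with h
  · apply moebius_of_not_squarefree
    intro hs
    exact hp.not_isUnit (hs p (mul_dvd_mul_left p h))
  · rw [((hp.irreducible.isRelPrime_iff_not_dvd).2 h).moebius_mul, hp.irreducible.moebius_eq,
      neg_one_mul]

open scoped Classical in
/-- The terms of a Möbius sum that are divisible by a prime `p` can be paired with the others. -/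
theorem tsum_moebius_mul_eq {α : Type*} [CommMonoidWithZero α] [UniqueFactorizationMonoid α]
    {p : α} (hp : Prime p) {g : α → ℝ} (hg : Summable g) :
    ∑' a, (moebius a : ℝ) * g a
      = ∑' a, if p ∣ a then 0 else (moebius a : ℝ) * (g a - g (p * a)) := by
  have hinj : Function.Injective (fun a : α => p * a) := mul_right_injective₀ hp.ne_zero
  have hmg : ∀ f : α → ℝ, Summable f → Summable fun a => (moebius a : ℝ) * f a := fun f hf =>
    Summable.of_norm_bounded hf.norm fun a => by
      rw [norm_mul, Real.norm_eq_abs]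
      exact mul_le_of_le_one_left (norm_nonneg _) (abs_moebius_le_one a)
  have h1 : Summable fun a => if p ∣ a then 0 else (moebius a : ℝ) * g a :=
    Summable.of_norm_bounded (hmg g hg).norm fun a => by split_ifs <;> simp [abs_nonneg, mul_nonneg]
  have h2 : Summable fun a => if p ∣ a then (moebius a : ℝ) * g a else 0 :=
    Summable.of_norm_bounded (hmg g hg).norm fun a => by split_ifs <;> simp [abs_nonneg, mul_nonneg]
  have h3 : Summable fun a => if p ∣ a then 0 else (moebius a : ℝ) * g (p * a) :=
    Summable.of_norm_bounded (hmg _ (hg.comp_injective hinj)).norm fun a => by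
      split_ifs <;> simp [abs_nonneg, mul_nonneg]
  have h4 : ∑' a, (if p ∣ a then (moebius a : ℝ) * g a else 0)
      = - ∑' a, if p ∣ a then 0 else (moebius a : ℝ) * g (p * a) := by
    rw [← hinj.tsum_eq, ← tsum_neg]
    · refine tsum_congr fun a => ?_
      rw [if_pos (dvd_mul_right p a), moebius_prime_mul hp]
      split_ifs <;> simp
    · intro a ha
      have : p ∣ a := by
        by_contra h
        simp [h] at ha
      obtain ⟨b, rfl⟩ := this
      exact ⟨b, rfl⟩
  calc ∑' a, (moebius a : ℝ) * g a
      = ∑' a, ((if p ∣ a then 0 else (moebius a : ℝ) * g a)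
          + if p ∣ a then (moebius a : ℝ) * g a else 0) :=
        tsum_congr fun a => by split_ifs <;> simp
    _ = _ := by
        rw [h1.tsum_add h2, h4, ← sub_eq_add_neg, ← h1.tsum_sub h3]
        refine tsum_congr fun a => ?_
        split_ifs
        · simp
        · ring

open scoped Classical in
/-- `∑_{I ∣ J} μ(I)` vanishes unless `J` is a unit. -/
theorem tsum_moebius_dvd {α : Type*} [CommMonoidWithZero α] [UniqueFactorizationMonoid α]
    {b : α} (hfin : {a : α | a ∣ b}.Finite) (hb : b ≠ 0) (hu : ¬ IsUnit b) :
    ∑' a, (moebius a : ℝ) * (if a ∣ b then 1 else 0) = 0 := by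
  obtain ⟨p, hp, hpb⟩ := WfDvdMonoid.exists_irreducible_factor hu hb
  -- With `p ∣ b` and `p ∤ a`, the conditions `a ∣ b` and `p a ∣ b` are equivalent, so every paired
  -- term cancels.
  rw [tsum_moebius_mul_eq hp.prime]
  · refine (tsum_congr fun a => ?_).trans tsum_zero
    split_ifs with h1 h2 h3 h3
    · rfl
    · simp
    · exact absurd (((hp.isRelPrime_iff_not_dvd).2 h1).mul_dvd hpb h2) h3
    · exact absurd ((dvd_mul_left a p).trans h3) h2
    · simp
  · exact summable_of_hasFiniteSupport (hfin.subset fun a ha => by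
      by_contra h
      simp at h
      simp [h] at ha)

end Moebius

/-! ### Möbius sums over the ideals of `ℤ[τ]` and the Euler factor at `√5` -/

namespace GoldenInt

open UniqueFactorizationMonoid

theorem finite_dvd {J : Ideal GoldenInt} (hJ : J ≠ 0) : {I : Ideal GoldenInt | I ∣ J}.Finite := by
  refine (Ideal.finite_setOfPred_absNorm_le (S := GoldenInt) (Ideal.absNorm J)).subset fun I hI => ?_
  exact Nat.le_of_dvd (Nat.pos_of_ne_zero (mt Ideal.absNorm_eq_zero_iff.1 hJ))
    (map_dvd Ideal.absNorm hI)

open scoped Classical in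
theorem tsum_moebius_dvd_ideal {J : Ideal GoldenInt} (hJ : J ≠ 0) :
    ∑' I, (moebius I : ℝ) * (if I ∣ J then 1 else 0) = if J = 1 then 1 else 0 := by
  split_ifs with h
  · rw [tsum_eq_single 1]
    · rw [moebius_one, h, if_pos (one_dvd _)]; simp
    · intro I hI
      have : ¬ I ∣ J := by rw [h, ← isUnit_iff_dvd_one, Ideal.isUnit_iff, ← Ideal.one_eq_top]; exact hI
      simp [this]
  · exact tsum_moebius_dvd (finite_dvd hJ) hJ (by rwa [Ideal.isUnit_iff, ← Ideal.one_eq_top])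

theorem normInvSq_mul (I J : Ideal GoldenInt) :
    normInvSq (I * J) = normInvSq I * normInvSq J := by
  simp [normInvSq, mul_pow, mul_comm]

theorem normInvSq_nonneg (I : Ideal GoldenInt) : 0 ≤ normInvSq I := by
  unfold normInvSq; positivity

theorem normInvSq_zero : normInvSq 0 = 0 := by simp [normInvSq]

theorem normInvSq_one : normInvSq 1 = 1 := by simp [normInvSq]

open scoped Classical in
theorem tsum_dvd_normInvSq {I : Ideal GoldenInt} (hI : I ≠ 0) :
    HasSum (fun J => (if I ∣ J then 1 else 0) * normInvSq J)
      (normInvSq I * ∑' J, normInvSq J) := by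
  have hinj : Function.Injective (fun J : Ideal GoldenInt => I * J) := mul_right_injective₀ hI
  rw [← hinj.hasSum_iff]
  · have : (fun J => (if I ∣ J then (1:ℝ) else 0) * normInvSq J) ∘ (fun J => I * J)
        = fun J => normInvSq I * normInvSq J := by
      funext J; simp [normInvSq_mul]
    rw [this]
    exact summable_normInvSq.hasSum.mul_left _
  · intro J hJ
    have : ¬ I ∣ J := fun ⟨b, hb⟩ => hJ ⟨b, hb.symm⟩
    simp [this]

/-- The double sum of `μ(I) N(J)⁻²` over `I ∣ J` is evaluated in both orders: summing over `J` first
gives the product, summing over `I` first leaves only `J = 1`. -/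
theorem tsum_moebius_mul_zeta :
    (∑' I, (moebius I : ℝ) * normInvSq I) * ∑' J, normInvSq J = 1 := by
  classical
  set Z := ∑' J, normInvSq J
  let F : Ideal GoldenInt → Ideal GoldenInt → ℝ := fun I J =>
    (moebius I : ℝ) * ((if I ∣ J then 1 else 0) * normInvSq J)
  have hF : ∀ I, HasSum (F I) ((moebius I : ℝ) * (normInvSq I * Z)) := fun I => by
    by_cases hI : I = 0
    · simp only [F, hI, moebius_zero]
      simp
    · exact (tsum_dvd_normInvSq hI).mul_left _
  have habs : ∀ I, HasSum (fun J => |F I J|) (|(moebius I : ℝ)| * (normInvSq I * Z)) := fun I => by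
    by_cases hI : I = 0
    · simp only [F, hI, moebius_zero]
      simp
    · convert! (tsum_dvd_normInvSq hI).mul_left |(moebius I : ℝ)| using 2 with J
      rw [abs_mul, abs_mul, abs_of_nonneg (normInvSq_nonneg J)]
      congr 2
      split_ifs <;> simp
  have hsum : Summable (Function.uncurry F) := by
    rw [← summable_norm_iff, summable_prod_of_nonneg (fun x => norm_nonneg _)]
    refine ⟨fun I => (habs I).summable, ?_⟩
    refine Summable.of_nonneg_of_le (fun I => tsum_nonneg fun J => norm_nonneg _) (fun I => ?_)
      (summable_normInvSq.mul_right Z)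
    change ∑' J, |F I J| ≤ _
    rw [(habs I).tsum_eq]
    refine mul_le_of_le_one_left (mul_nonneg (normInvSq_nonneg I) (tsum_nonneg normInvSq_nonneg))
      (abs_moebius_le_one I)
  have h := hsum.tsum_comm
  rw [← tsum_mul_right]
  calc ∑' I, (moebius I : ℝ) * normInvSq I * Z = ∑' I, ∑' J, F I J :=
        tsum_congr fun I => by rw [(hF I).tsum_eq, mul_assoc]
    _ = ∑' J, ∑' I, F I J := h.symm
    _ = ∑' J : Ideal GoldenInt, if J = 1 then 1 else 0 := by
        refine tsum_congr fun J => ?_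
        by_cases hJ : J = 0
        · subst hJ
          have : (0 : Ideal GoldenInt) ≠ 1 := zero_ne_one
          simp only [F, normInvSq_zero, mul_zero, tsum_zero, if_neg this]
        · have : ∀ I, F I J = ((moebius I : ℝ) * (if I ∣ J then 1 else 0)) * normInvSq J :=
            fun I => by simp only [F]; ring
          simp_rw [this]
          rw [tsum_mul_right, tsum_moebius_dvd_ideal hJ]
          split_ifs with h1
          · rw [h1, normInvSq_one, one_mul]
          · rw [zero_mul]
    _ = 1 := tsum_ite_eq 1 1

/-- The prime ideal above `5`. -/
def fivePrime : Ideal GoldenInt := Ideal.span {⟨-1, 2⟩}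

theorem dvd_iff_mod5_eq_zero (d : GoldenInt) : fivePrime ∣ Ideal.span {d} ↔ mod5 d = 0 := by
  rw [fivePrime, Ideal.dvd_iff_le, Ideal.span_singleton_le_span_singleton, mod5_apply]
  constructor
  · rintro ⟨c, rfl⟩
    have := map_mul mod5 ⟨-1, 2⟩ c
    rw [mod5_apply, mod5_apply] at this
    rw [this]
    have h : ((-1 : ℤ) : ZMod 5) + ((2 : ℤ) : ZMod 5) * 3 = 0 := by decide
    rw [h, zero_mul]
  · intro h
    have h2 : (((d.re + d.im * 3 : ℤ)) : ZMod 5) = 0 := by push_cast; exact h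
    rw [ZMod.intCast_zmod_eq_zero_iff_dvd] at h2
    obtain ⟨m, hm⟩ := h2
    -- The coordinates of `d / √5` when `d.re + 3 d.im = 5m`.
    refine ⟨⟨d.im - m, 2 * m - d.im⟩, ?_⟩
    push_cast at hm
    ext
    · simp only [QuadraticAlgebra.re_mul]; linarith
    · simp only [QuadraticAlgebra.im_mul]; ring

theorem absNorm_fivePrime : Ideal.absNorm fivePrime = 5 := by
  have h : (Ideal.absNorm fivePrime : ℝ) = 5 := by
    rw [fivePrime, absNorm_span_singleton, toReal_mul_conj, QuadraticAlgebra.norm_def]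
    norm_num
  exact_mod_cast h

theorem prime_fivePrime : Prime fivePrime := by
  have h5 := absNorm_fivePrime
  have hp : fivePrime.IsPrime := Ideal.isPrime_of_irreducible_absNorm (by
    rw [h5]; exact Nat.prime_five)
  exact Ideal.prime_of_isPrime (by intro h; rw [h] at h5; simp at h5) hp

theorem normInvSq_fivePrime : normInvSq fivePrime = 1 / 25 := by
  rw [normInvSq, absNorm_fivePrime]
  norm_num

open scoped Classical in
/-- The Möbius sum over the ideals of `ℤ[τ]` prime to `5`. -/
theorem tsum_moebius_coprime_five :
    ∑' I, (if fivePrime ∣ I then 0 else (moebius I : ℝ) * normInvSq I)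
      = 25 / 24 / ∑' I, normInvSq I := by
  have h1 := tsum_moebius_mul_zeta
  rw [tsum_moebius_mul_eq prime_fivePrime summable_normInvSq] at h1
  -- Pairing `I` with `√5 I` leaves each term prime to `√5` with the factor `1 - 5⁻² = 24/25`.
  have h2 : ∀ I, (if fivePrime ∣ I then 0
      else (moebius I : ℝ) * (normInvSq I - normInvSq (fivePrime * I)))
      = 24 / 25 * (if fivePrime ∣ I then 0 else (moebius I : ℝ) * normInvSq I) := fun I => by
    split_ifs
    · simp
    · rw [normInvSq_mul, normInvSq_fivePrime]; ring
  simp_rw [h2] at h1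
  rw [tsum_mul_left] at h1
  have hZ : ∑' I, normInvSq I ≠ 0 := right_ne_zero_of_mul_eq_one h1
  rw [eq_div_iff hZ]
  linarith

end GoldenInt

end PenroseVisible

namespace PenroseVisible

/-! ### Counting lattice points -/

section LatticeCount

variable {V : Type*} [NormedAddCommGroup V] [NormedSpace ℝ V]

/-- A segment is connected, so one leading from `E` to its complement meets the frontier. -/
theorem exists_frontier_dist_le {E : Set V} {x y : V} (hx : x ∈ E) (hy : y ∉ E) :
    ∃ z ∈ frontier E, dist x z ≤ dist x y := by
  by_contra! h
  have hseg : ∀ z ∈ segment ℝ x y, z ∉ frontier E := fun z hz hzf => by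
    have h1 := h z hzf
    have h2 := dist_add_dist_of_mem_segment hz
    linarith [dist_nonneg (x := z) (y := y)]
  have hxs := left_mem_segment ℝ x y
  have hys := right_mem_segment ℝ x y
  have hpre : IsPreconnected (segment ℝ x y) := (convex_segment x y).isPreconnected
  obtain ⟨z, -, hz1, hz2⟩ := hpre (interior E) (closure E)ᶜ isOpen_interior
    isClosed_closure.isOpen_compl (fun z hz => by
      by_contra h0
      simp only [Set.mem_union, Set.mem_compl_iff, not_or, not_not] at h0
      exact hseg z hz ⟨h0.2, h0.1⟩)
    ⟨x, hxs, by
      by_contra h0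
      exact hseg x hxs ⟨subset_closure hx, h0⟩⟩
    ⟨y, hys, fun h0 => hseg y hys ⟨h0, fun h1 => hy (interior_subset h1)⟩⟩
  exact hz2 (subset_closure (interior_subset hz1))

theorem mem_union_cthickening_frontier {E : Set V} {x y : V} {δ : ℝ} (hy : y ∈ E)
    (hxy : dist x y ≤ δ) : x ∈ E ∪ Metric.cthickening δ (frontier E) := by
  by_cases hx : x ∈ E
  · exact Or.inl hx
  · right
    have hx' : x ∈ Eᶜ := hx
    obtain ⟨z, hz, hd⟩ := exists_frontier_dist_le hx' (not_not.2 hy : ¬ y ∈ Eᶜ)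
    rw [frontier_compl] at hz
    exact Metric.mem_cthickening_of_dist_le x z δ _ hz (hd.trans hxy)

theorem mem_union_cthickening_frontier' {E : Set V} {x y : V} {δ : ℝ} (hx : x ∈ E)
    (hxy : dist x y ≤ δ) : y ∈ E ∨ x ∈ Metric.cthickening δ (frontier E) := by
  by_cases hy : y ∈ E
  · exact Or.inl hy
  · right
    obtain ⟨z, hz, hd⟩ := exists_frontier_dist_le hx hy
    exact Metric.mem_cthickening_of_dist_le x z δ _ hz (hd.trans hxy)

variable {ι : Type*} [Fintype ι] (b : Module.Basis ι ℝ V)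

/-- The point of the lattice spanned by `b` with coordinates `v`. -/
def latticePoint (v : ι → ℤ) : V := ∑ i, (v i : ℝ) • b i

theorem existsUnique_sub_latticePoint_mem (x : V) :
    ∃! v : ι → ℤ, x - latticePoint b v ∈ ZSpan.fundamentalDomain b := by
  have h : ∀ v : ι → ℤ, x - latticePoint b v ∈ ZSpan.fundamentalDomain b ↔
      ∀ i, v i = ⌊b.repr x i⌋ := fun v => by
    rw [ZSpan.mem_fundamentalDomain]
    refine forall_congr' fun i => ?_
    have : b.repr (latticePoint b v) i = v i := by
      rw [latticePoint, b.repr_sum_self]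
    rw [map_sub, Finsupp.sub_apply, this, eq_comm, Int.floor_eq_iff, Set.mem_Ico, sub_nonneg,
      sub_lt_iff_lt_add']
  refine ⟨fun i => ⌊b.repr x i⌋, (h _).2 fun i => rfl, fun v hv => funext ((h v).1 hv)⟩

variable [FiniteDimensional ℝ V] [MeasurableSpace V] [BorelSpace V]
  (μ : Measure V) [μ.IsAddHaarMeasure]

/-- The number of lattice points in the preimage of a bounded set with negligible boundary,
under affine maps whose linear parts shrink to zero. -/
theorem tendsto_ncard_latticePoint_mul {α : Type*} {l : Filter α} {E : Set V}
    (hE : Bornology.IsBounded E) (hfr : μ (frontier E) = 0) (T : α → V →L[ℝ] V) (w : α → V)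
    (hdet : ∀ j, LinearMap.det (T j : V →ₗ[ℝ] V) ≠ 0) (hT : Tendsto (fun j => ‖T j‖) l (𝓝 0)) :
    Tendsto (fun j => ({v : ι → ℤ | T j (latticePoint b v) + w j ∈ E}.ncard : ℝ) *
      (|LinearMap.det (T j : V →ₗ[ℝ] V)| * (μ (ZSpan.fundamentalDomain b)).toReal)) l
      (𝓝 (μ E).toReal) := by
  set F := ZSpan.fundamentalDomain b
  obtain ⟨R, hR⟩ := (ZSpan.fundamentalDomain_isBounded b).exists_norm_le
  -- The cells `A j v` tile the space and have diameter shrinking with `‖T j‖`. The union `U j` of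
  -- those with base point in `E` has volume equal to the count times the cell volume, and differs
  -- from `E` only inside a thickening of the frontier, whose measure tends to 0.
  let S : α → Set (ι → ℤ) := fun j => {v | T j (latticePoint b v) + w j ∈ E}
  let A : α → (ι → ℤ) → Set V := fun j v =>
    (fun x => T j (latticePoint b v) + w j + x) '' (T j '' F)
  let U : α → Set V := fun j => ⋃ v ∈ S j, A j v
  let ε : α → ENNReal := fun j => μ (Metric.cthickening (‖T j‖ * R) (frontier E))
  have hinj : ∀ j, Function.Injective (T j) := fun j => by
    have := ((T j).toContinuousLinearEquivOfDetNeZero (hdet j)).injective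
    rwa [← ContinuousLinearEquiv.coe_coe,
      ContinuousLinearMap.coe_toContinuousLinearEquivOfDetNeZero] at this
  have hsurj : ∀ j, Function.Surjective (T j) := fun j => by
    have := ((T j).toContinuousLinearEquivOfDetNeZero (hdet j)).surjective
    rwa [← ContinuousLinearEquiv.coe_coe,
      ContinuousLinearMap.coe_toContinuousLinearEquivOfDetNeZero] at this
  have hAmem : ∀ j v f, T j f + w j ∈ A j v ↔ f - latticePoint b v ∈ F := fun j v f => by
    constructor
    · rintro ⟨_, ⟨f', hf', rfl⟩, hx⟩
      have : T j (latticePoint b v + f') = T j f := by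
        rw [map_add]
        have h2 : T j (latticePoint b v) + w j + T j f' = T j f + w j := hx
        have h3 : T j (latticePoint b v) + T j f' + w j = T j f + w j := by rw [← h2]; abel
        exact add_right_cancel h3
      rw [← hinj j this, add_sub_cancel_left]; exact hf'
    · intro hf
      refine ⟨_, ⟨_, hf, rfl⟩, ?_⟩
      simp only [map_sub]; abel
  have hrep : ∀ j x, ∃ f, x = T j f + w j := fun j x => by
    obtain ⟨f, hf⟩ := hsurj j (x - w j)
    exact ⟨f, by rw [hf]; abel⟩
  have hdist : ∀ j v x, x ∈ A j v → dist x (T j (latticePoint b v) + w j) ≤ ‖T j‖ * R := by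
    rintro j v _ ⟨_, ⟨f, hf, rfl⟩, rfl⟩
    rw [dist_eq_norm, add_sub_cancel_left]
    exact ((T j).le_opNorm f).trans (mul_le_mul_of_nonneg_left (hR f hf) (norm_nonneg _))
  have hcover : ∀ j x, ∃ v, x ∈ A j v := fun j x => by
    obtain ⟨f, rfl⟩ := hrep j x
    obtain ⟨v, hv, -⟩ := existsUnique_sub_latticePoint_mem b f
    exact ⟨v, (hAmem j v f).2 hv⟩
  have hdisj : ∀ j, Pairwise (Function.onFun Disjoint (A j)) := fun j v v' hne => by
    refine Set.disjoint_left.2 fun x hx hx' => hne ?_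
    obtain ⟨f, rfl⟩ := hrep j x
    exact (existsUnique_sub_latticePoint_mem b f).unique ((hAmem j v f).1 hx) ((hAmem j v' f).1 hx')
  have hmeas : ∀ j v, MeasurableSet (A j v) := fun j v => by
    have h1 : MeasurableSet (T j '' F) := by
      rw [show (T j '' F) = ((T j).toContinuousLinearEquivOfDetNeZero (hdet j)) '' F by
        rw [← ContinuousLinearEquiv.coe_coe,
          ContinuousLinearMap.coe_toContinuousLinearEquivOfDetNeZero]]
      exact (((T j).toContinuousLinearEquivOfDetNeZero
        (hdet j)).toHomeomorph.measurableEmbedding.measurableSet_image).2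
        (ZSpan.fundamentalDomain_measurableSet b)
    exact (measurableEmbedding_addLeft _).measurableSet_image.2 h1
  have hvol : ∀ j, μ (U j)
      = (S j).encard * (ENNReal.ofReal |LinearMap.det (T j : V →ₗ[ℝ] V)| * μ F) := fun j => by
    rw [measure_biUnion (Set.to_countable _) (fun v _ v' _ h => hdisj j h) (fun v _ => hmeas j v),
      ← ENNReal.tsum_set_const]
    refine tsum_congr fun v => ?_
    rw [show A j v = (fun x => -(T j (latticePoint b v) + w j) + x) ⁻¹' (T j '' F) from
      Set.image_add_left, measure_preimage_add, Measure.addHaar_image_continuousLinearMap]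
  have hupper : ∀ j, μ (U j) ≤ μ E + ε j := fun j => by
    refine (measure_mono fun x hx => ?_).trans (measure_union_le _ _)
    obtain ⟨v, hv, hxv⟩ := Set.mem_iUnion₂.1 hx
    exact mem_union_cthickening_frontier hv (hdist j v x hxv)
  have hlower : ∀ j, μ E ≤ μ (U j) + ε j := fun j => by
    refine (measure_mono fun x hx => ?_).trans (measure_union_le _ _)
    obtain ⟨v, hv⟩ := hcover j x
    rcases mem_union_cthickening_frontier' hx (hdist j v x hv) with h | h
    · exact Or.inl (Set.mem_biUnion (s := S j) h hv)
    · exact Or.inr h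
  have hfrb : Bornology.IsBounded (frontier E) := hE.closure.subset frontier_subset_closure
  have hε : Tendsto ε l (𝓝 0) := by
    have h1 := tendsto_measure_cthickening_of_isClosed (μ := μ) (s := frontier E)
      ⟨1, one_pos, (hfrb.cthickening.measure_lt_top).ne⟩ isClosed_frontier
    rw [hfr] at h1
    exact h1.comp (by simpa using hT.mul_const R)
  have hlim : Tendsto (fun j => μ (U j)) l (𝓝 (μ E)) := by
    have hEt : μ E ≠ ⊤ := hE.measure_lt_top.ne
    refine tendsto_of_tendsto_of_tendsto_of_le_of_le (g := fun j => μ E - ε j)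
      (h := fun j => μ E + ε j) ?_ ?_ (fun j => tsub_le_iff_right.2 (hlower j)) hupper
    · simpa using ENNReal.Tendsto.sub (tendsto_const_nhds (x := μ E)) hε (Or.inl hEt)
    · simpa using (tendsto_const_nhds (x := μ E)).add hε
  have := (ENNReal.tendsto_toReal hE.measure_lt_top.ne).comp hlim
  refine this.congr fun j => ?_
  simp only [Function.comp_apply, hvol, ENNReal.toReal_mul,
    ENNReal.toReal_ofReal (abs_nonneg _)]
  congr 1
  -- Infinite counts agree by convention: both `ncard` and the real value of `⊤` are 0.
  change _ = (((S j).encard.toNat : ℕ) : ℝ)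
  induction (S j).encard using ENat.recTopCoe <;> simp

end LatticeCount

end PenroseVisible

namespace PenroseVisible

/-! ### The fifth root of unity in coordinates -/

theorem goldenRatio_bounds : 1.618 < Real.goldenRatio ∧ Real.goldenRatio < 1.6181 := by
  have h5 : (2.236 : ℝ) < √5 := by
    rw [Real.lt_sqrt (by norm_num)]; norm_num
  have h5' : √5 < (2.2361 : ℝ) := by
    rw [Real.sqrt_lt' (by norm_num)]; norm_num
  rw [Real.goldenRatio]
  constructor <;> linarith

theorem zeta5_re : zeta5.re = (Real.goldenRatio - 1) / 2 := by
  have h : zeta5.re = Real.cos (2 * Real.pi / 5) := by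
    unfold zeta5
    simp [Complex.exp_re]
  rw [h, show 2 * Real.pi / 5 = 2 * (Real.pi / 5) by ring, Real.cos_two_mul, Real.cos_pi_div_five,
    Real.goldenRatio]
  have := Real.sq_sqrt (show (0:ℝ) ≤ 5 by norm_num)
  linear_combination (1 / 8) * this

theorem zeta5_im_pos : 0 < zeta5.im := by
  have h : zeta5.im = Real.sin (2 * Real.pi / 5) := by
    unfold zeta5
    simp [Complex.exp_im]
  rw [h]
  exact Real.sin_pos_of_pos_of_lt_pi (by positivity) (by linarith [Real.pi_pos])

theorem norm_zeta5 : ‖zeta5‖ = 1 := zeta5_isPrimitiveRoot.norm'_eq_one (by norm_num)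

theorem zeta5_im_sq : zeta5.im ^ 2 = (Real.goldenRatio + 2) / 4 := by
  have h := Complex.sq_norm zeta5
  rw [norm_zeta5, Complex.normSq_apply, zeta5_re] at h
  linear_combination (-1 : ℝ) * h - (1 / 4) * Real.goldenRatio_sq

theorem zeta5_sq_re : (zeta5 ^ 2).re = - Real.goldenRatio / 2 := by
  rw [sq, Complex.mul_re, ← sq, ← sq, zeta5_im_sq, zeta5_re]
  linear_combination (1 / 4) * Real.goldenRatio_sq

theorem zeta5_sq_im : (zeta5 ^ 2).im = (Real.goldenRatio - 1) * zeta5.im := by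
  rw [sq, Complex.mul_im, zeta5_re]
  ring

/-! ### Pairs of golden integers as points of the plane -/

open GoldenInt

/-- The point `a + bζ` of the plane. -/
def phys (x : GoldenInt × GoldenInt) : ℂ := (toReal x.1 : ℂ) + (toReal x.2 : ℂ) * zeta5

/-- The conjugate `σ(a + bζ)`. -/
def intl (x : GoldenInt × GoldenInt) : ℂ := (conj x.1 : ℂ) + (conj x.2 : ℂ) * zeta5 ^ 2

/-- The residue `κ(a + bζ)`. -/
def res (x : GoldenInt × GoldenInt) : ZMod 5 := mod5 x.1 + mod5 x.2

theorem phys_smul (d : GoldenInt) (x : GoldenInt × GoldenInt) :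
    phys (d • x) = toReal d * phys x := by
  simp [phys, mul_add, mul_assoc]

theorem intl_smul (d : GoldenInt) (x : GoldenInt × GoldenInt) :
    intl (d • x) = conj d * intl x := by
  simp [intl, mul_add, mul_assoc]

theorem res_smul (d : GoldenInt) (x : GoldenInt × GoldenInt) :
    res (d • x) = mod5 d * res x := by
  simp [res, mul_add]

/-- The standard real basis of `ℂ × ℂ`. -/
def planeBasis : Module.Basis (Fin 4) ℝ (ℂ × ℂ) :=
  (Complex.basisOneI.prod Complex.basisOneI).reindex finSumFinEquiv

theorem planeBasis_repr (x : ℂ × ℂ) : ⇑(planeBasis.repr x) = ![x.1.re, x.1.im, x.2.re, x.2.im] := by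
  have h0 : finSumFinEquiv.symm (0 : Fin (2 + 2)) = Sum.inl 0 := rfl
  have h1 : finSumFinEquiv.symm (1 : Fin (2 + 2)) = Sum.inl 1 := rfl
  have h2 : finSumFinEquiv.symm (2 : Fin (2 + 2)) = Sum.inr 0 := rfl
  have h3 : finSumFinEquiv.symm (3 : Fin (2 + 2)) = Sum.inr 1 := rfl
  ext i
  fin_cases i <;> simp [planeBasis, h0, h1, h2, h3]

theorem planeBasis_apply :
    ⇑planeBasis = ![((1 : ℂ), (0 : ℂ)), (Complex.I, 0), (0, 1), (0, Complex.I)] := by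
  have h0 : finSumFinEquiv.symm (0 : Fin (2 + 2)) = Sum.inl 0 := rfl
  have h1 : finSumFinEquiv.symm (1 : Fin (2 + 2)) = Sum.inl 1 := rfl
  have h2 : finSumFinEquiv.symm (2 : Fin (2 + 2)) = Sum.inr 0 := rfl
  have h3 : finSumFinEquiv.symm (3 : Fin (2 + 2)) = Sum.inr 1 := rfl
  ext i
  all_goals fin_cases i <;> simp [planeBasis, h0, h1, h2, h3]

theorem volume_fundamentalDomain_planeBasis :
    (volume : Measure (ℂ × ℂ)) (ZSpan.fundamentalDomain planeBasis) = 1 := by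
  have h : ZSpan.fundamentalDomain planeBasis =
      (Complex.measurableEquivPi ⁻¹' (Set.univ.pi fun _ => Set.Ico 0 1)) ×ˢ
      (Complex.measurableEquivPi ⁻¹' (Set.univ.pi fun _ => Set.Ico 0 1)) := by
    ext x
    simp [ZSpan.mem_fundamentalDomain, planeBasis_repr, Complex.measurableEquivPi, Fin.forall_fin_succ]
    tauto
  have h1 : volume (Complex.measurableEquivPi ⁻¹' (Set.univ.pi fun _ => Set.Ico (0:ℝ) 1)) = 1 := by
    rw [Complex.volume_preserving_equiv_pi.measure_preimage
      (MeasurableSet.pi Set.countable_univ (fun _ _ => measurableSet_Ico)).nullMeasurableSet,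
      volume_pi, Measure.pi_pi]
    simp
  rw [h, Measure.volume_eq_prod, Measure.prod_prod, h1, one_mul]

/-- The real-linear extension of `(phys, intl)` to the plane, in coordinates on the sublattice
`res = 0`. -/
def cosetMap : ℂ × ℂ →ₗ[ℝ] ℂ × ℂ where
  toFun x :=
    (((5 * x.1.re + 2 * x.1.im - x.2.re + 2 * x.2.im + x.1.im * Real.goldenRatio : ℝ) : ℂ)
        + ((x.2.re + x.2.im * Real.goldenRatio : ℝ) : ℂ) * zeta5,
      ((5 * x.1.re + 2 * x.1.im - x.2.re + 2 * x.2.im + x.1.im * Real.goldenConj : ℝ) : ℂ)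
        + ((x.2.re + x.2.im * Real.goldenConj : ℝ) : ℂ) * zeta5 ^ 2)
  map_add' x y := by
    ext1 <;> simp only [Prod.fst_add, Prod.snd_add, Complex.add_re, Complex.add_im] <;>
      push_cast <;> ring
  map_smul' c x := by
    ext1 <;> simp only [Prod.smul_fst, Prod.smul_snd, Complex.real_smul, Complex.re_ofReal_mul,
      Complex.im_ofReal_mul, RingHom.id_apply] <;> push_cast <;> ring

/-- In absolute value this is the covolume `5√5/4` of `ℤ[ζ]` under `(id, σ)` times 5, the index of
the kernel of `κ`. -/
theorem det_cosetMap : LinearMap.det cosetMap = -(25 * √5 / 4) := by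
  have hM : LinearMap.toMatrix planeBasis planeBasis cosetMap =
      !![5, 2 + Real.goldenRatio, -1 + zeta5.re, 2 + Real.goldenRatio * zeta5.re;
        0, 0, zeta5.im, Real.goldenRatio * zeta5.im;
        5, 2 + Real.goldenConj, -1 + (zeta5 ^ 2).re, 2 + Real.goldenConj * (zeta5 ^ 2).re;
        0, 0, (zeta5 ^ 2).im, Real.goldenConj * (zeta5 ^ 2).im] := by
    ext i j
    rw [LinearMap.toMatrix_apply, planeBasis_repr, planeBasis_apply]
    fin_cases j <;> fin_cases i <;>
      simp [cosetMap]
  rw [← LinearMap.det_toMatrix planeBasis, hM]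
  simp [Matrix.det_succ_row_zero, Fin.sum_univ_succ, Fin.succAbove]
  rw [zeta5_sq_im]
  have h1 := zeta5_im_sq
  have h2 := Real.goldenRatio_sq
  rw [← Real.goldenRatio_sub_goldenConj, ← Real.one_sub_goldenConj]
  linear_combination (-5 * (Real.goldenRatio - 1) * (2 * Real.goldenRatio - 1) ^ 2) * h1
    - (5 / 4) * (4 * (2 * Real.goldenRatio - 1) + 5
      + 4 * (Real.goldenRatio ^ 2 - Real.goldenRatio - 1)) * h2

/-- Coordinates on the coset `res = c` of `ℤ[τ] × ℤ[τ]`. -/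
def cosetPoint (c : ℤ) (v : Fin 4 → ℤ) : GoldenInt × GoldenInt :=
  (⟨c + 5 * v 0 + 2 * v 1 - v 2 + 2 * v 3, v 1⟩, ⟨v 2, v 3⟩)

theorem cosetPoint_injective (c : ℤ) : Function.Injective (cosetPoint c) := by
  intro v w h
  simp only [cosetPoint, Prod.mk.injEq, QuadraticAlgebra.mk.injEq] at h
  obtain ⟨⟨h0, h1⟩, h2, h3⟩ := h
  ext i
  fin_cases i
  · change v 0 = w 0; omega
  · exact h1
  · exact h2
  · exact h3

theorem range_cosetPoint (c : ℤ) : Set.range (cosetPoint c) = {x | res x = (c : ZMod 5)} := by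
  have h5 : (5 : ZMod 5) = 0 := by decide
  ext x
  constructor
  · rintro ⟨v, rfl⟩
    simp only [Set.mem_ofPred_eq, res, cosetPoint, mod5_apply]
    push_cast
    linear_combination ((v 0 : ZMod 5) + v 1 + v 3) * h5
  · intro hx
    simp only [Set.mem_ofPred_eq, res, mod5_apply] at hx
    have h2 : ((x.1.re + x.1.im * 3 + (x.2.re + x.2.im * 3) - c : ℤ) : ZMod 5) = 0 := by
      push_cast
      rw [hx, sub_self]
    rw [ZMod.intCast_zmod_eq_zero_iff_dvd] at h2
    obtain ⟨m, hm⟩ := h2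
    push_cast at hm
    refine ⟨![m - x.1.im - x.2.im, x.1.im, x.2.re, x.2.im], ?_⟩
    ext
    · change c + 5 * (m - x.1.im - x.2.im) + 2 * x.1.im - x.2.re + 2 * x.2.im = x.1.re
      linarith
    · rfl
    · rfl
    · rfl

theorem cosetMap_latticePoint (c : ℤ) (v : Fin 4 → ℤ) :
    cosetMap (latticePoint planeBasis v) + ((c : ℂ), (c : ℂ))
      = (phys (cosetPoint c v), intl (cosetPoint c v)) := by
  have hv : latticePoint planeBasis v = (⟨v 0, v 1⟩, ⟨v 2, v 3⟩) := by
    rw [latticePoint, planeBasis_apply]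
    ext <;> simp [Fin.sum_univ_four, Complex.mk_eq_add_mul_I]
  rw [hv]
  ext1 <;> simp only [cosetMap, LinearMap.coe_mk, AddHom.coe_mk, phys, intl, cosetPoint,
    toReal_apply, conj_apply, Prod.fst_add, Prod.snd_add] <;> push_cast <;> ring

/-- Scaling of the two factors of `ℂ × ℂ` after `cosetMap`, as a continuous linear map. -/
def scaledCosetMap (r₁ r₂ : ℝ) : ℂ × ℂ →L[ℝ] ℂ × ℂ :=
  r₁ • (((LinearMap.inl ℝ ℂ ℂ).comp (LinearMap.fst ℝ ℂ ℂ)).comp cosetMap).toContinuousLinearMap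
  + r₂ • (((LinearMap.inr ℝ ℂ ℂ).comp (LinearMap.snd ℝ ℂ ℂ)).comp cosetMap).toContinuousLinearMap

theorem scaledCosetMap_apply (r₁ r₂ : ℝ) (x : ℂ × ℂ) :
    scaledCosetMap r₁ r₂ x = ((r₁ : ℂ) * (cosetMap x).1, (r₂ : ℂ) * (cosetMap x).2) := by
  simp [scaledCosetMap]

theorem det_scaledCosetMap (r₁ r₂ : ℝ) :
    LinearMap.det (scaledCosetMap r₁ r₂ : ℂ × ℂ →ₗ[ℝ] ℂ × ℂ)
      = (r₁ * r₂) ^ 2 * LinearMap.det cosetMap := by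
  have h : (scaledCosetMap r₁ r₂ : ℂ × ℂ →ₗ[ℝ] ℂ × ℂ) =
      (LinearMap.prodMap (r₁ • LinearMap.id) (r₂ • LinearMap.id)).comp cosetMap := by
    refine LinearMap.ext fun x => ?_
    rw [ContinuousLinearMap.coe_coe, scaledCosetMap_apply]
    simp
  rw [h, LinearMap.det_comp, LinearMap.det_prodMap, LinearMap.det_smul, LinearMap.det_smul]
  simp [Complex.finrank_real_complex, mul_pow]

/-- The number of points of a residue class with `(r₁ x, r₂ σ(x))` in a bounded set. -/
theorem tendsto_ncard_res {α : Type*} {l : Filter α} {D W : Set ℂ} (hD : JordanMeasurable D)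
    (hW : JordanMeasurable W) (c : ZMod 5) {r₁ r₂ : α → ℝ} (h₁ : ∀ j, r₁ j ≠ 0)
    (h₂ : ∀ j, r₂ j ≠ 0) (hr₁ : Tendsto r₁ l (𝓝 0)) (hr₂ : Tendsto r₂ l (𝓝 0)) :
    Tendsto (fun j => ({x | res x = c ∧ (r₁ j : ℂ) * phys x ∈ D ∧ (r₂ j : ℂ) * intl x ∈ W}.ncard : ℝ)
      * ((r₁ j * r₂ j) ^ 2 * (25 * √5 / 4))) l (𝓝 ((volume D).toReal * (volume W).toReal)) := by
  obtain ⟨c, rfl⟩ := ZMod.intCast_surjective c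
  have hfr : (volume : Measure (ℂ × ℂ)) (frontier (D ×ˢ W)) = 0 := by
    rw [frontier_prod_eq]
    refine measure_union_null ?_ ?_ <;> rw [Measure.volume_eq_prod, Measure.prod_prod]
    · rw [hW.2, mul_zero]
    · rw [hD.2, zero_mul]
  have hdet : |LinearMap.det cosetMap| = 25 * √5 / 4 := by
    rw [det_cosetMap, abs_neg, abs_of_pos (by positivity)]
  have : (volume : Measure (ℂ × ℂ)).IsAddHaarMeasure := by
    rw [Measure.volume_eq_prod]; infer_instance
  have h := tendsto_ncard_latticePoint_mul (l := l) planeBasis volume (hD.1.prod hW.1) hfr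
    (fun j => scaledCosetMap (r₁ j) (r₂ j)) (fun j => ((r₁ j : ℂ) * c, (r₂ j : ℂ) * c))
    (fun j => by
      rw [det_scaledCosetMap]
      refine mul_ne_zero (pow_ne_zero _ (mul_ne_zero (h₁ j) (h₂ j))) ?_
      rw [← abs_pos, hdet]; positivity)
    (by
      rw [← tendsto_zero_iff_norm_tendsto_zero]
      have := (hr₁.smul_const (((LinearMap.inl ℝ ℂ ℂ).comp
        (LinearMap.fst ℝ ℂ ℂ)).comp cosetMap).toContinuousLinearMap).add
        (hr₂.smul_const (((LinearMap.inr ℝ ℂ ℂ).comp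
        (LinearMap.snd ℝ ℂ ℂ)).comp cosetMap).toContinuousLinearMap)
      have h0 : scaledCosetMap 0 0 = 0 := 
        ContinuousLinearMap.ext fun x => by simp [scaledCosetMap_apply]
      rw [← h0]
      exact this)
  rw [Measure.volume_eq_prod, Measure.prod_prod, ENNReal.toReal_mul] at h
  refine h.congr fun j => ?_
  rw [← Measure.volume_eq_prod, volume_fundamentalDomain_planeBasis, ENNReal.toReal_one, mul_one,
    det_scaledCosetMap, abs_mul, abs_of_nonneg (sq_nonneg _), hdet]
  congr 2
  rw [← Set.ncard_image_of_injective _ (cosetPoint_injective c)]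
  congr 1
  have key : ∀ v, (scaledCosetMap (r₁ j) (r₂ j)) (latticePoint planeBasis v)
      + ((r₁ j : ℂ) * c, (r₂ j : ℂ) * c)
      = ((r₁ j : ℂ) * phys (cosetPoint c v), (r₂ j : ℂ) * intl (cosetPoint c v)) := fun v => by
    have := cosetMap_latticePoint c v
    rw [Prod.ext_iff] at this
    simp only [Prod.fst_add, Prod.snd_add] at this
    rw [scaledCosetMap_apply, Prod.mk_add_mk, ← mul_add, ← mul_add, this.1, this.2]
  ext x
  constructor
  · rintro ⟨v, hv, rfl⟩
    rw [Set.mem_ofPred_eq, key, Set.mem_prod] at hv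
    refine ⟨?_, hv⟩
    have : cosetPoint c v ∈ Set.range (cosetPoint c) := ⟨v, rfl⟩
    rwa [range_cosetPoint] at this
  · rintro ⟨hx, hx'⟩
    have : x ∈ Set.range (cosetPoint c) := by rw [range_cosetPoint]; exact hx
    obtain ⟨v, rfl⟩ := this
    refine ⟨v, ?_, rfl⟩
    rw [Set.mem_ofPred_eq, key, Set.mem_prod]
    exact hx'

end PenroseVisible

namespace PenroseVisible

open GoldenInt

/-! ### Uniform bounds for the number of points in a product of discs -/

/-- The imaginary parts control `b` and `b'` in `a + bζ`, the real parts then control `a` and `a'`,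
and sums and differences of conjugates recover the integer coordinates. -/
theorem exists_abs_le_of_norm_le {x : GoldenInt × GoldenInt} {ρ : ℝ} (hp : ‖phys x‖ ≤ ρ)
    (hi : ‖intl x‖ ≤ ρ) :
    |(x.1.re : ℝ)| ≤ 5 * ρ ∧ |(x.1.im : ℝ)| ≤ 5 * ρ ∧ |(x.2.re : ℝ)| ≤ 5 * ρ ∧
      |(x.2.im : ℝ)| ≤ 5 * ρ := by
  obtain ⟨hg, hg'⟩ := goldenRatio_bounds
  have hs := zeta5_im_sq
  have hs0 := zeta5_im_pos
  have hs1 : 0.95 < zeta5.im := by nlinarith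
  have hp1 := (Complex.abs_re_le_norm _).trans hp
  have hp2 := (Complex.abs_im_le_norm _).trans hp
  have hi1 := (Complex.abs_re_le_norm _).trans hi
  have hi2 := (Complex.abs_im_le_norm _).trans hi
  simp only [phys, intl, Complex.add_re, Complex.add_im, Complex.ofReal_re, Complex.ofReal_im,
    Complex.re_ofReal_mul, Complex.im_ofReal_mul, zero_add, zeta5_sq_re, zeta5_sq_im,
    zeta5_re] at hp1 hp2 hi1 hi2
  have hρ : 0 ≤ ρ := (norm_nonneg _).trans hp
  have hb : |toReal x.2| ≤ 1.1 * ρ := by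
    rw [abs_mul, abs_of_pos hs0] at hp2
    nlinarith [abs_nonneg (toReal x.2)]
  have hb' : |conj x.2| ≤ 1.75 * ρ := by
    rw [abs_mul, abs_of_pos (mul_pos (by linarith) hs0)] at hi2
    have : 0.58 < (Real.goldenRatio - 1) * zeta5.im := by nlinarith
    nlinarith [abs_nonneg (conj x.2)]
  have h5 : (2.236 : ℝ) < √5 := by
    rw [Real.lt_sqrt (by norm_num)]; norm_num
  rw [abs_le] at hb hb' hp1 hi1
  have ha : |toReal x.1| ≤ 3.2 * ρ := by
    rw [abs_le]; constructor <;> nlinarith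
  have ha' : |conj x.1| ≤ 3.2 * ρ := by
    rw [abs_le]; constructor <;> nlinarith
  rw [abs_le] at ha ha'
  have d1 := toReal_sub_conj x.1
  have d2 := toReal_sub_conj x.2
  have e1 := toReal_add_conj x.1
  have e2 := toReal_add_conj x.2
  have him : ∀ t : ℝ, |t * √5| ≤ 6.4 * ρ → |t| ≤ 3 * ρ := fun t ht => by
    rw [abs_mul, abs_of_pos (by linarith : (0:ℝ) < √5)] at ht
    nlinarith [abs_nonneg t]
  have i1 := abs_le.1 (him x.1.im (by rw [← d1, abs_le]; constructor <;> linarith))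
  have i2 := abs_le.1 (him x.2.im (by rw [← d2, abs_le]; constructor <;> linarith))
  refine ⟨?_, ?_, ?_, ?_⟩ <;> rw [abs_le] <;> constructor <;> linarith

/-- Excluding 0 avoids an additive constant: for `ρ < 1/5` nothing is left, and otherwise `n = ⌊5ρ⌋
≥ 1` gives at most `2n + 1 ≤ 15ρ` values per coordinate. -/
theorem finite_ncard_le_of_norm_le (ρ : ℝ) :
    {x : GoldenInt × GoldenInt | x ≠ 0 ∧ ‖phys x‖ ≤ ρ ∧ ‖intl x‖ ≤ ρ}.Finite ∧
    ({x : GoldenInt × GoldenInt | x ≠ 0 ∧ ‖phys x‖ ≤ ρ ∧ ‖intl x‖ ≤ ρ}.ncard : ℝ)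
      ≤ (15 * ρ) ^ 4 := by
  set S := {x : GoldenInt × GoldenInt | x ≠ 0 ∧ ‖phys x‖ ≤ ρ ∧ ‖intl x‖ ≤ ρ}
  let f : GoldenInt × GoldenInt → ℤ × ℤ × ℤ × ℤ := fun x => (x.1.re, x.1.im, x.2.re, x.2.im)
  have hf : Function.Injective f := fun x y h => by
    simp only [f, Prod.mk.injEq] at h
    ext
    exacts [h.1, h.2.1, h.2.2.1, h.2.2.2]
  set n : ℕ := ⌊5 * ρ⌋₊
  let B : Finset ℤ := Finset.Icc (-(n : ℤ)) n
  have hB : B.card = 2 * n + 1 := by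
    simp only [B, Int.card_Icc]; omega
  have hint : ∀ m : ℤ, |(m : ℝ)| ≤ 5 * ρ → m ∈ B := fun m hm => by
    rw [Finset.mem_Icc, ← abs_le, Int.abs_eq_natAbs, Nat.cast_le]
    apply Nat.le_floor
    rwa [Nat.cast_natAbs, Int.cast_abs]
  have hmaps : ∀ x ∈ S, f x ∈ (B ×ˢ B ×ˢ B ×ˢ B : Finset (ℤ × ℤ × ℤ × ℤ)) := fun x hx => by
    obtain ⟨h1, h2, h3, h4⟩ := exists_abs_le_of_norm_le hx.2.1 hx.2.2
    simp only [Finset.mem_product]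
    exact ⟨hint _ h1, hint _ h2, hint _ h3, hint _ h4⟩
  have hfin : S.Finite :=
    ((B ×ˢ B ×ˢ B ×ˢ B).finite_toSet.preimage hf.injOn).subset fun x hx => hmaps x hx
  refine ⟨hfin, ?_⟩
  rcases Nat.eq_zero_or_pos n with hn | hn
  · have hS : S = ∅ := by
      refine Set.eq_empty_of_forall_notMem fun x hx => hx.1 (hf ?_)
      have := hmaps x hx
      simp only [Finset.mem_product, B, hn, Finset.mem_Icc, f] at this
      simp only [f]
      ext <;> simp <;> omega
    rw [hS, Set.ncard_empty]
    push_cast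
    positivity
  · have h1 : S.ncard ≤ (2 * n + 1) ^ 4 := by
      have := Set.ncard_le_ncard_of_injOn (t := ((B ×ˢ B ×ˢ B ×ˢ B : Finset _) : Set _)) f hmaps
        hf.injOn (Finset.finite_toSet _)
      rw [Set.ncard_coe_finset] at this
      simp only [Finset.card_product, hB] at this
      refine this.trans (le_of_eq (by ring))
    have h2 : (n : ℝ) ≤ 5 * ρ := by
      apply Nat.floor_le
      by_contra h
      have : n = 0 := Nat.floor_of_nonpos (not_le.1 h).le
      omega
    have h3 : (1 : ℝ) ≤ n := by exact_mod_cast hn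
    calc (S.ncard : ℝ) ≤ (2 * n + 1) ^ 4 := by exact_mod_cast h1
      _ ≤ (15 * ρ) ^ 4 := by gcongr; linarith

theorem smul_injective_of_ne_zero {d : GoldenInt} (hd : d ≠ 0) :
    Function.Injective (fun x : GoldenInt × GoldenInt => d • x) := fun x y h => by
  simp only [Prod.ext_iff, Prod.smul_fst, Prod.smul_snd, smul_eq_mul] at h
  exact Prod.ext (mul_left_cancel₀ hd h.1) (mul_left_cancel₀ hd h.2)

/-- Multiplication by a power of `τ` shrinks one embedding as much as it enlarges the other, so both
radii can be brought below `2√(R₁R₂)`. -/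
theorem finite_ncard_le_of_norm_le_of_norm_le {R₁ R₂ : ℝ} (h₁ : 0 < R₁) (h₂ : 0 < R₂) :
    {x : GoldenInt × GoldenInt | x ≠ 0 ∧ ‖phys x‖ ≤ R₁ ∧ ‖intl x‖ ≤ R₂}.Finite ∧
    ({x : GoldenInt × GoldenInt | x ≠ 0 ∧ ‖phys x‖ ≤ R₁ ∧ ‖intl x‖ ≤ R₂}.ncard : ℝ)
      ≤ 30 ^ 4 * (R₁ * R₂) ^ 2 := by
  set q := √(R₁ / R₂)
  have hq : 0 < q := Real.sqrt_pos.2 (by positivity)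
  have hqq : q ^ 2 * R₂ = R₁ := by
    rw [Real.sq_sqrt (by positivity)]; field_simp
  obtain ⟨n, hn, hn'⟩ := exists_mem_Ico_zpow hq Real.one_lt_goldenRatio
  have hgp := zpow_pos Real.goldenRatio_pos n
  rw [zpow_add_one₀ Real.goldenRatio_ne_zero] at hn'
  have hfin := finite_ncard_le_of_norm_le (2 * (R₂ * q))
  have hne : ((tauUnit ^ (-n) : GoldenIntˣ) : GoldenInt) ≠ 0 := Units.ne_zero _
  have hmaps : ∀ x ∈ {x : GoldenInt × GoldenInt | x ≠ 0 ∧ ‖phys x‖ ≤ R₁ ∧ ‖intl x‖ ≤ R₂},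
      ((tauUnit ^ (-n) : GoldenIntˣ) : GoldenInt) • x ∈
      {x : GoldenInt × GoldenInt | x ≠ 0 ∧ ‖phys x‖ ≤ 2 * (R₂ * q) ∧ ‖intl x‖ ≤ 2 * (R₂ * q)} := by
    rintro x ⟨hx0, hxp, hxi⟩
    refine ⟨?_, ?_, ?_⟩
    · intro h
      apply hx0
      apply smul_injective_of_ne_zero hne
      simpa using h
    · rw [phys_smul, norm_mul, Complex.norm_real, Real.norm_eq_abs, toReal_tauUnit_zpow,
        abs_of_pos (zpow_pos Real.goldenRatio_pos _), zpow_neg, inv_mul_le_iff₀ hgp]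
      refine hxp.trans ?_
      rw [← hqq]
      have := goldenRatio_bounds.2
      nlinarith [mul_pos h₂ hq, mul_pos (mul_pos h₂ hq) hgp]
    · rw [intl_smul, norm_mul, Complex.norm_real, Real.norm_eq_abs, abs_conj_tauUnit_zpow, zpow_neg,
        inv_inv]
      nlinarith [norm_nonneg (intl x), mul_pos h₂ hq, mul_le_mul hn hxi (norm_nonneg _) hq.le]
  constructor
  · exact (hfin.1.preimage (smul_injective_of_ne_zero hne).injOn).subset hmaps
  · have h3 := Set.ncard_le_ncard_of_injOn _ hmaps (smul_injective_of_ne_zero hne).injOn hfin.1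
    have h4 : (15 * (2 * (R₂ * q))) ^ 4 = 30 ^ 4 * (R₁ * R₂) ^ 2 := by
      rw [← hqq]; ring
    rw [← h4]
    exact le_trans (by exact_mod_cast h3) hfin.2

/-! ### Points with a given divisor -/

/-- The points of residue `k` with physical coordinate in `T • D` and internal coordinate in `W`. -/
def region (k : ZMod 5) (D W : Set ℂ) (T : ℝ) : Set (GoldenInt × GoldenInt) :=
  {x | res x = k ∧ phys x ∈ T • D ∧ intl x ∈ W}

theorem region_inter_smul (k : ZMod 5) (D W : Set ℂ) (T : ℝ) (d : GoldenInt) :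
    {x ∈ region k D W T | ∃ y, x = d • y} = (fun y => d • y) ''
      {y | mod5 d * res y = k ∧ (toReal d : ℂ) * phys y ∈ T • D ∧ (conj d : ℂ) * intl y ∈ W} := by
  ext x
  constructor
  · rintro ⟨⟨h1, h2, h3⟩, y, rfl⟩
    rw [res_smul] at h1
    rw [phys_smul] at h2
    rw [intl_smul] at h3
    exact ⟨y, ⟨h1, h2, h3⟩, rfl⟩
  · rintro ⟨y, ⟨h1, h2, h3⟩, rfl⟩
    refine ⟨⟨?_, ?_, ?_⟩, y, rfl⟩
    · rwa [res_smul]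
    · change phys (d • y) ∈ _
      rwa [phys_smul]
    · change intl (d • y) ∈ _
      rwa [intl_smul]

/-- Dividing by `d` turns these points into nonzero ones in a product of discs with radii scaled by
`1/|d|` and `1/|d'|`. Uniformity in `T` and `d` provides the dominating series for the Möbius sum.
-/
theorem exists_region_bound {k : ZMod 5} (hk : k ≠ 0) {D W : Set ℂ} (hD : Bornology.IsBounded D)
    (hW : Bornology.IsBounded W) : ∃ C : ℝ, 0 ≤ C ∧ ∀ T : ℝ, 0 < T → ∀ d : GoldenInt, d ≠ 0 →
      {x ∈ region k D W T | ∃ y, x = d • y}.Finite ∧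
      ({x ∈ region k D W T | ∃ y, x = d • y}.ncard : ℝ)
        ≤ C * T ^ 2 / (toReal d * conj d) ^ 2 := by
  obtain ⟨r₁, hr₁, hD'⟩ := hD.exists_pos_norm_le
  obtain ⟨r₂, hr₂, hW'⟩ := hW.exists_pos_norm_le
  refine ⟨30 ^ 4 * (r₁ * r₂) ^ 2, by positivity, fun T hT d hd => ?_⟩
  have hd1 : 0 < |toReal d| := abs_pos.2 ((map_ne_zero_iff _ toReal_injective).2 hd)
  have hd2 : 0 < |conj d| := abs_pos.2 ((map_ne_zero_iff _ conj_injective).2 hd)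
  have hbox := finite_ncard_le_of_norm_le_of_norm_le (R₁ := T * r₁ / |toReal d|)
    (R₂ := r₂ / |conj d|) (by positivity) (by positivity)
  have hsub : {y | mod5 d * res y = k ∧ (toReal d : ℂ) * phys y ∈ T • D ∧
      (conj d : ℂ) * intl y ∈ W} ⊆
      {x : GoldenInt × GoldenInt | x ≠ 0 ∧ ‖phys x‖ ≤ T * r₁ / |toReal d| ∧
        ‖intl x‖ ≤ r₂ / |conj d|} := by
    rintro y ⟨h1, ⟨z, hz, hz'⟩, h3⟩
    refine ⟨?_, ?_, ?_⟩
    · rintro rfl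
      simp [res] at h1
      exact hk h1.symm
    · rw [le_div_iff₀ hd1, ← Real.norm_eq_abs, ← Complex.norm_real, mul_comm, ← norm_mul, ← hz']
      change ‖T • z‖ ≤ _
      rw [norm_smul, Real.norm_of_nonneg hT.le]
      exact mul_le_mul_of_nonneg_left (hD' z hz) hT.le
    · rw [le_div_iff₀ hd2, ← Real.norm_eq_abs, ← Complex.norm_real, mul_comm, ← norm_mul]
      exact hW' _ h3
  rw [region_inter_smul]
  refine ⟨(hbox.1.subset hsub).image _, ?_⟩
  rw [Set.ncard_image_of_injective _ (smul_injective_of_ne_zero hd)]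
  have h1 : (Set.ncard _ : ℝ) ≤ _ := Nat.cast_le.2 (Set.ncard_le_ncard hsub hbox.1)
  refine h1.trans (hbox.2.trans (le_of_eq ?_))
  rw [← sq_abs (toReal d * conj d), abs_mul]
  field_simp

theorem exists_exponent : ∃ m : ℝ → ℕ, Tendsto m atTop atTop ∧
    ∀ T : ℝ, 1 ≤ T → Real.goldenRatio ^ (4 * m T) * Real.goldenRatio ^ (4 * m T) ≤ T := by
  have h1 : 1 < Real.goldenRatio ^ 8 := one_lt_pow₀ Real.one_lt_goldenRatio (by norm_num)
  refine ⟨fun T => ⌊Real.logb (Real.goldenRatio ^ 8) T⌋₊,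
    tendsto_nat_floor_atTop.comp (Real.tendsto_logb_atTop h1), fun T hT => ?_⟩
  rw [← pow_add, ← two_mul, ← mul_assoc, pow_mul]
  norm_num only
  rw [← Real.rpow_natCast]
  have h2 : ((⌊Real.logb (Real.goldenRatio ^ 8) T⌋₊ : ℕ) : ℝ) ≤ Real.logb (Real.goldenRatio ^ 8) T :=
    Nat.floor_le (Real.logb_nonneg h1 hT)
  calc _ ≤ (Real.goldenRatio ^ 8) ^ (Real.logb (Real.goldenRatio ^ 8) T) :=
        Real.rpow_le_rpow_of_exponent_le h1.le h2
    _ = T := Real.rpow_logb (by positivity) h1.ne' (by positivity)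

/-- The window `W` is fixed while `T • D` grows, so the lattice count does not apply directly.
Writing `x = d u y` with a unit `u = τ^{4m}`, `m` growing slowly with `T`, makes both scaling
factors `d u / T` and `(d u)'` tend to 0. Exponents divisible by 4 give `u ≡ 1` modulo `√5`, so the
residue class of `y` stays constant. -/
theorem tendsto_ncard_region_dvd (k : ZMod 5) {D W : Set ℂ} (hD : JordanMeasurable D)
    (hW : JordanMeasurable W) {d : GoldenInt} (hd : mod5 d ≠ 0) :
    Tendsto (fun T : ℝ => ({x ∈ region k D W T | ∃ y, x = d • y}.ncard : ℝ) / T ^ 2) atTop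
      (𝓝 ((volume D).toReal * (volume W).toReal * (4 / (25 * √5)) / (toReal d * conj d) ^ 2)) := by
  have : Fact (Nat.Prime 5) := ⟨Nat.prime_five⟩
  obtain ⟨m, hm, hmT⟩ := exists_exponent
  have hd0 : d ≠ 0 := by rintro rfl; simp at hd
  have hd1 : toReal d ≠ 0 := (map_ne_zero_iff _ toReal_injective).2 hd0
  have hd2 : conj d ≠ 0 := (map_ne_zero_iff _ conj_injective).2 hd0
  have hpsi : |Real.goldenConj| < 1 := abs_lt.2 ⟨Real.neg_one_lt_goldenConj,
    Real.goldenConj_neg.trans one_pos⟩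
  let u : ℝ → GoldenInt := fun T => ((tauUnit ^ (4 * m T) : GoldenIntˣ) : GoldenInt)
  have hu1 : ∀ T, toReal (u T) = Real.goldenRatio ^ (4 * m T) := fun T => by
    have := toReal_tauUnit_zpow (4 * m T : ℕ)
    rwa [zpow_natCast, zpow_natCast] at this
  have hu2 : ∀ T, conj (u T) = Real.goldenConj ^ (4 * m T) := fun T => by
    have := conj_tauUnit_zpow (4 * m T : ℕ)
    rwa [zpow_natCast, zpow_natCast] at this
  have hu12 : ∀ T, toReal (u T) * conj (u T) = 1 := fun T => by
    rw [hu1, hu2, ← mul_pow, Real.goldenRatio_mul_goldenConj, pow_mul]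
    norm_num
  have hu0 : ∀ T, u T ≠ 0 := fun T => Units.ne_zero _
  have hconj : Tendsto (fun T => conj (u T)) atTop (𝓝 0) := by
    simp_rw [hu2]
    have h4 : Tendsto (fun T => 4 * m T) atTop atTop := hm.const_mul_atTop' (by norm_num)
    exact (tendsto_pow_atTop_nhds_zero_of_abs_lt_one hpsi).comp h4
  -- The choice of `m` gives `u² ≤ T`, hence `u / T ≤ 1 / u = u'`.
  have hreal : Tendsto (fun T => toReal (u T) / T) atTop (𝓝 0) := by
    refine squeeze_zero_norm' ?_ (by simpa using hconj.norm)
    filter_upwards [eventually_ge_atTop 1] with T hT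
    have hpos : 0 < toReal (u T) := by rw [hu1]; exact pow_pos Real.goldenRatio_pos _
    have h1 := hmT T hT
    rw [← hu1] at h1
    rw [norm_div, Real.norm_of_nonneg hpos.le, Real.norm_of_nonneg (by linarith),
      div_le_iff₀ (by linarith)]
    refine le_trans ?_ (mul_le_mul_of_nonneg_right (le_abs_self _) (by linarith))
    have h2 := hu12 T
    have h3 : 0 < conj (u T) := pos_of_mul_pos_right (by rw [h2]; exact one_pos) hpos.le
    nlinarith
  have h := tendsto_ncard_res (l := atTop) hD hW (k / mod5 d)
    -- The value at `T = 0` only keeps the factor nonzero everywhere.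
    (r₁ := fun T : ℝ => if T = 0 then 1 else toReal (d * u T) / T) (r₂ := fun T => conj (d * u T))
    (fun T => by
      split_ifs with h0
      · exact one_ne_zero
      · exact div_ne_zero ((map_ne_zero_iff _ toReal_injective).2 (mul_ne_zero hd0 (hu0 T))) h0)
    (fun T => (map_ne_zero_iff _ conj_injective).2 (mul_ne_zero hd0 (hu0 T)))
    (by
      have := hreal.const_mul (toReal d)
      rw [mul_zero] at this
      refine this.congr' ?_
      filter_upwards [eventually_gt_atTop 0] with T hT
      rw [if_neg hT.ne', map_mul, mul_div_assoc])
    (by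
      have := hconj.const_mul (conj d)
      rw [mul_zero] at this
      exact this.congr fun T => (map_mul _ _ _).symm)
  have h' := (h.mul_const (4 / (25 * √5))).div_const ((toReal d * conj d) ^ 2)
  refine h'.congr' ?_
  filter_upwards [eventually_gt_atTop 0] with T hT
  have hdu : {x ∈ region k D W T | ∃ y, x = d • y} = {x ∈ region k D W T | ∃ y, x = (d * u T) • y} := by
    ext x
    refine and_congr_right fun _ => ⟨?_, ?_⟩
    · rintro ⟨y, rfl⟩
      refine ⟨((tauUnit ^ (4 * m T))⁻¹ : GoldenIntˣ) • y, ?_⟩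
      rw [mul_smul]
      congr 1
      exact (smul_inv_smul (tauUnit ^ (4 * m T)) y).symm
    · rintro ⟨y, rfl⟩
      exact ⟨u T • y, mul_smul _ _ _⟩
  have hset : {y | mod5 (d * u T) * res y = k ∧ (toReal (d * u T) : ℂ) * phys y ∈ T • D ∧
      (conj (d * u T) : ℂ) * intl y ∈ W} = {x | res x = k / mod5 d ∧
      ((if T = 0 then 1 else toReal (d * u T) / T : ℝ) : ℂ) * phys x ∈ D ∧
      (conj (d * u T) : ℂ) * intl x ∈ W} := by
    ext y
    have h5 : mod5 (d * u T) = mod5 d := by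
      rw [map_mul, mod5_tauUnit_pow_four, mul_one]
    rw [Set.mem_ofPred_eq, Set.mem_ofPred_eq, h5, eq_div_iff hd, mul_comm (res y),
      Set.mem_smul_set_iff_inv_smul_mem₀ hT.ne', if_neg hT.ne', Complex.real_smul]
    have h6 : ((T⁻¹ : ℝ) : ℂ) * ((toReal (d * u T) : ℂ) * phys y)
        = ((toReal (d * u T) / T : ℝ) : ℂ) * phys y := by
      push_cast; ring
    rw [h6]
  rw [hdu, region_inter_smul, Set.ncard_image_of_injective _
    (smul_injective_of_ne_zero (mul_ne_zero hd0 (hu0 T))), hset, if_neg hT.ne']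
  have h7 : toReal (d * u T) / T * conj (d * u T) = toReal d * conj d / T := by
    rw [map_mul, map_mul]
    linear_combination (toReal d * conj d / T) * hu12 T
  have h5 : √5 ≠ 0 := by positivity
  rw [h7]
  generalize Set.ncard _ = N
  field_simp

end PenroseVisible

namespace PenroseVisible

open GoldenInt UniqueFactorizationMonoid

/-! ### The density of primitive points -/

/-- The coordinates of `a + bζ` are coprime. -/
def IsPrimitive (x : GoldenInt × GoldenInt) : Prop := Ideal.span {x.1, x.2} = 1

theorem span_singleton_dvd_iff (d : GoldenInt) (x : GoldenInt × GoldenInt) :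
    Ideal.span {d} ∣ Ideal.span {x.1, x.2} ↔ ∃ y, x = d • y := by
  rw [Ideal.dvd_iff_le, Ideal.span_le, Set.pair_subset_iff, SetLike.mem_coe, SetLike.mem_coe,
    Ideal.mem_span_singleton, Ideal.mem_span_singleton]
  constructor
  · rintro ⟨⟨a, ha⟩, ⟨b, hb⟩⟩
    exact ⟨(a, b), Prod.ext ha hb⟩
  · rintro ⟨y, rfl⟩
    exact ⟨⟨y.1, rfl⟩, ⟨y.2, rfl⟩⟩

theorem finite_region {k : ZMod 5} (hk : k ≠ 0) {D W : Set ℂ} (hD : Bornology.IsBounded D)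
    (hW : Bornology.IsBounded W) {T : ℝ} (hT : 0 < T) : (region k D W T).Finite := by
  obtain ⟨C, -, h⟩ := exists_region_bound hk hD hW
  refine (h T hT 1 one_ne_zero).1.subset fun x hx => ⟨hx, x, (one_smul _ x).symm⟩

/-- Summing `∑_{I ∣ J} μ(I) = [J = 1]` over the finitely many points of the region, with `J` the
ideal of their coordinates. The nonzero residue rules out `x = 0`, so `J ≠ 0`. -/
theorem ncard_primitive_eq_tsum {k : ZMod 5} (hk : k ≠ 0) {D W : Set ℂ}
    (hD : Bornology.IsBounded D) (hW : Bornology.IsBounded W) {T : ℝ} (hT : 0 < T) :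
    ({x ∈ region k D W T | IsPrimitive x}.ncard : ℝ) =
      ∑' I : Ideal GoldenInt,
        (moebius I : ℝ) * ({x ∈ region k D W T | I ∣ Ideal.span {x.1, x.2}}.ncard : ℝ) := by
  classical
  have hfin := finite_region hk hD hW hT
  set S := hfin.toFinset with hS
  have hcard : ∀ P : GoldenInt × GoldenInt → Prop,
      ({x ∈ region k D W T | P x}.ncard : ℝ) = ∑ x ∈ S, if P x then 1 else 0 := fun P => by
    have : {x ∈ region k D W T | P x} = (S.filter P : Set _) := by
      ext x; simp [hS]
    rw [this, Set.ncard_coe_finset, Finset.card_filter]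
    push_cast; rfl
  have hne : ∀ x ∈ S, Ideal.span {x.1, x.2} ≠ 0 := fun x hx h => by
    rw [hS, Set.Finite.mem_toFinset] at hx
    have h1 : x.1 ∈ Ideal.span {x.1, x.2} := Ideal.subset_span (by simp)
    have h2 : x.2 ∈ Ideal.span {x.1, x.2} := Ideal.subset_span (by simp)
    rw [h] at h1 h2
    have h3 := hx.1
    rw [res, Ideal.mem_bot.1 h1, Ideal.mem_bot.1 h2] at h3
    simp at h3
    exact hk h3.symm
  have hsum : ∀ x ∈ S, Summable fun I : Ideal GoldenInt =>
      (moebius I : ℝ) * (if I ∣ Ideal.span {x.1, x.2} then 1 else 0) := fun x hx =>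
    summable_of_hasFiniteSupport ((finite_dvd (hne x hx)).subset fun I hI => by
      by_contra h
      simp only [Set.mem_ofPred_eq] at h
      simp [h] at hI)
  simp_rw [hcard, Finset.mul_sum]
  rw [Summable.tsum_finsetSum hsum]
  exact Finset.sum_congr rfl fun x hx => (tsum_moebius_dvd_ideal (hne x hx)).symm

theorem exists_generator (I : Ideal GoldenInt) : ∃ d, I = Ideal.span {d} :=
  (IsPrincipalIdealRing.principal I).principal

theorem normInvSq_span_singleton (d : GoldenInt) :
    normInvSq (Ideal.span {d}) = 1 / (toReal d * conj d) ^ 2 := by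
  rw [normInvSq, absNorm_span_singleton, sq_abs, one_div]

theorem tendsto_ncard_primitive {k : ZMod 5} (hk : k ≠ 0) {D W : Set ℂ}
    (hD : JordanMeasurable D) (hW : JordanMeasurable W) :
    Tendsto (fun T : ℝ => ({x ∈ region k D W T | IsPrimitive x}.ncard : ℝ) / T ^ 2) atTop
      (𝓝 ((volume D).toReal * (volume W).toReal * (1 / (6 * √5)) / ∑' I, normInvSq I)) := by
  classical
  obtain ⟨C, hC, hbound⟩ := exists_region_bound hk hD.1 hW.1
  -- The constant is `4/(25√5) · 25/24 = 1/(6√5)`.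
  have hlim : (volume D).toReal * (volume W).toReal * (1 / (6 * √5)) / ∑' I, normInvSq I
      = ∑' I : Ideal GoldenInt, (volume D).toReal * (volume W).toReal * (4 / (25 * √5)) *
        (if fivePrime ∣ I then 0 else (moebius I : ℝ) * normInvSq I) := by
    rw [tsum_mul_left, tsum_moebius_coprime_five]
    have h5 : √5 ≠ 0 := by positivity
    field_simp
    ring
  rw [hlim]
  have hset : ∀ d T, {x ∈ region k D W T | Ideal.span {d} ∣ Ideal.span {x.1, x.2}}
      = {x ∈ region k D W T | ∃ y, x = d • y} := fun d T => by
    ext x; exact and_congr_right fun _ => span_singleton_dvd_iff d x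
  have hmain := tendsto_tsum_of_dominated_convergence (𝓕 := atTop)
    (f := fun (T : ℝ) (I : Ideal GoldenInt) => (moebius I : ℝ) *
      (({x ∈ region k D W T | I ∣ Ideal.span {x.1, x.2}}.ncard : ℝ) / T ^ 2))
    (g := fun I => (volume D).toReal * (volume W).toReal * (4 / (25 * √5)) *
        (if fivePrime ∣ I then 0 else (moebius I : ℝ) * normInvSq I))
    (bound := fun I => C * normInvSq I) (summable_normInvSq.mul_left C) ?_ ?_
  · refine hmain.congr' ?_
    filter_upwards [eventually_gt_atTop 0] with T hT
    rw [ncard_primitive_eq_tsum hk hD.1 hW.1 hT, ← tsum_div_const]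
    exact tsum_congr fun I => (mul_div_assoc _ _ _).symm
  · intro I
    obtain ⟨d, rfl⟩ := exists_generator I
    simp_rw [hset, dvd_iff_mod5_eq_zero]
    split_ifs with h
    · rw [mul_zero]
      refine tendsto_const_nhds.congr fun T => ?_
      have : {x ∈ region k D W T | ∃ y, x = d • y} = ∅ := by
        refine Set.eq_empty_of_forall_notMem ?_
        rintro x ⟨⟨hx, -⟩, y, rfl⟩
        rw [res_smul, h, zero_mul] at hx
        exact hk hx.symm
      rw [this]; simp
    · have := (tendsto_ncard_region_dvd k hD hW h).const_mul (moebius (Ideal.span {d}) : ℝ)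
      rw [show (volume D).toReal * (volume W).toReal * (4 / (25 * √5)) *
        ((moebius (Ideal.span {d}) : ℝ) * normInvSq (Ideal.span {d})) =
        (moebius (Ideal.span {d}) : ℝ) * ((volume D).toReal * (volume W).toReal *
          (4 / (25 * √5)) / (toReal d * conj d) ^ 2) by rw [normInvSq_span_singleton]; ring]
      exact this
  · filter_upwards [eventually_gt_atTop 0] with T hT I
    obtain ⟨d, rfl⟩ := exists_generator I
    rw [hset, norm_mul, Real.norm_eq_abs]
    -- The uniform bound needs `d ≠ 0`; the zero ideal is killed by `μ(0) = 0`.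
    by_cases hd : d = 0
    · subst hd
      have : moebius (Ideal.span {(0 : GoldenInt)}) = 0 := by
        rw [Ideal.span_singleton_eq_bot.2 rfl]; exact moebius_zero
      rw [this]
      simp [normInvSq_nonneg, mul_nonneg hC]
    · refine (mul_le_of_le_one_left (norm_nonneg _) (abs_moebius_le_one _)).trans ?_
      rw [Real.norm_of_nonneg (by positivity), div_le_iff₀ (by positivity),
        normInvSq_span_singleton]
      refine ((hbound T hT d hd).2).trans (le_of_eq ?_)
      ring

end PenroseVisible

namespace PenroseVisible

open GoldenInt

/-! ### The ring `ℤ[ζ]` in terms of pairs of golden integers -/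

theorem zeta5_sq : zeta5 ^ 2 = ((Real.goldenRatio : ℂ) - 1) * zeta5 - 1 := by
  rw [← Complex.ofReal_one, ← Complex.ofReal_sub]
  apply Complex.ext
  · rw [zeta5_sq_re, Complex.sub_re, Complex.re_ofReal_mul, zeta5_re, Complex.ofReal_re]
    linear_combination (-1 / 2) * Real.goldenRatio_sq
  · rw [zeta5_sq_im, Complex.sub_im, Complex.im_ofReal_mul, Complex.ofReal_im, sub_zero]

theorem ofReal_goldenRatio_sq : (Real.goldenRatio : ℂ) ^ 2 = Real.goldenRatio + 1 := by
  exact_mod_cast Real.goldenRatio_sq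

theorem zeta5_pow_three : zeta5 ^ 3 = ((Real.goldenRatio : ℂ) - 1) * zeta5 ^ 2 - zeta5 := by
  linear_combination zeta5 * zeta5_sq

theorem zeta5_pow_four : zeta5 ^ 4 = -(Real.goldenRatio : ℂ) * zeta5 ^ 2 - 1 := by
  have h := zeta5_sq
  linear_combination (zeta5 ^ 2 + (Real.goldenRatio - 1) * zeta5 + 1) * h
    + zeta5 ^ 2 * ofReal_goldenRatio_sq

theorem exists_phys_eq (x : ZZeta) :
    ∃ m, (x : ℂ) = phys m ∧ sigma x = intl m ∧ kappa x = res m := by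
  obtain ⟨x, hx⟩ := x
  induction hx using Algebra.adjoin_induction with
  | mem x hx =>
    obtain rfl := Set.mem_singleton_iff.1 hx
    have h : (⟨zeta5, Algebra.subset_adjoin hx⟩ : ZZeta) = zetaGen := rfl
    rw [h]
    refine ⟨(0, 1), ?_, ?_, ?_⟩
    · simp [phys, zetaGen]
    · simp [intl, sigma_zetaGen]
    · simp [res, kappa_zetaGen]
  | algebraMap n =>
    have h : (⟨algebraMap ℤ ℂ n, (Algebra.adjoin ℤ {zeta5}).algebraMap_mem n⟩ : ZZeta)
        = algebraMap ℤ ZZeta n := rfl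
    rw [h]
    refine ⟨((n : GoldenInt), 0), ?_, ?_, ?_⟩
    · simp [phys]
    · simp [intl]
    · simp [res]
  | add x y hx hy h1 h2 =>
    obtain ⟨m, p1, i1, r1⟩ := h1
    obtain ⟨n, p2, i2, r2⟩ := h2
    have h : (⟨x + y, add_mem hx hy⟩ : ZZeta) = ⟨x, hx⟩ + ⟨y, hy⟩ := rfl
    rw [h]
    refine ⟨m + n, ?_, ?_, ?_⟩
    · change x + y = _
      change x = _ at p1
      change y = _ at p2
      rw [p1, p2]; simp [phys]; ring
    · rw [map_add, i1, i2]; simp [intl]; ring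
    · rw [map_add, r1, r2]; simp [res]; ring
  | mul x y hx hy h1 h2 =>
    obtain ⟨m, p1, i1, r1⟩ := h1
    obtain ⟨n, p2, i2, r2⟩ := h2
    have h : (⟨x * y, mul_mem hx hy⟩ : ZZeta) = ⟨x, hx⟩ * ⟨y, hy⟩ := rfl
    rw [h]
    -- Multiplication of pairs under `ζ² = (τ - 1)ζ - 1`; the golden integer `⟨-1, 1⟩` is `τ - 1`.
    refine ⟨(m.1 * n.1 - m.2 * n.2, m.1 * n.2 + m.2 * n.1 + ⟨-1, 1⟩ * (m.2 * n.2)), ?_, ?_, ?_⟩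
    · change x * y = _
      change x = _ at p1
      change y = _ at p2
      have e : toReal ⟨-1, 1⟩ = Real.goldenRatio - 1 := by rw [toReal_apply]; push_cast; ring
      rw [p1, p2]
      simp only [phys, map_sub, map_add, map_mul, e]
      have := zeta5_sq
      push_cast at this ⊢
      linear_combination ((toReal m.2 : ℂ) * toReal n.2) * this
    · have e : conj ⟨-1, 1⟩ = - Real.goldenRatio := by rw [conj_eq]; push_cast; ring
      rw [map_mul, i1, i2]
      simp only [intl, map_sub, map_add, map_mul, e]
      have := zeta5_pow_four
      push_cast at this ⊢
      linear_combination ((conj m.2 : ℂ) * conj n.2) * this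
    · have e : mod5 ⟨-1, 1⟩ = 2 := by rw [mod5_apply]; decide
      rw [map_mul, r1, r2]
      simp only [res, map_sub, map_add, map_mul, e]
      ring

theorem exists_eq_phys (m : GoldenInt × GoldenInt) :
    ∃ x : ZZeta, (x : ℂ) = phys m ∧ sigma x = intl m ∧ kappa x = res m := by
  have h2 := zeta5_sq
  have h4 := zeta5_pow_four
  have hg := ofReal_goldenRatio_sq
  -- `τ = 1 + ζ + ζ⁴`.
  refine ⟨(m.1.re : ZZeta) + m.1.im * (1 + zetaGen + zetaGen ^ 4)
    + (m.2.re + m.2.im * (1 + zetaGen + zetaGen ^ 4)) * zetaGen, ?_, ?_, ?_⟩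
  · have e : 1 + zeta5 + zeta5 ^ 4 = Real.goldenRatio := by
      linear_combination h4 - (Real.goldenRatio : ℂ) * h2 - zeta5 * hg
    push_cast
    change (m.1.re : ℂ) + m.1.im * (1 + zeta5 + zeta5 ^ 4)
      + (m.2.re + m.2.im * (1 + zeta5 + zeta5 ^ 4)) * zeta5 = _
    rw [e, phys, toReal_apply, toReal_apply]
    push_cast
    ring
  · have e : 1 + zeta5 ^ 2 + (zeta5 ^ 2) ^ 4 = 1 - Real.goldenRatio := by
      have h8 : (zeta5 ^ 2) ^ 4 = (-(Real.goldenRatio : ℂ) * zeta5 ^ 2 - 1) ^ 2 := by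
        rw [← h4]; ring
      rw [h8]
      linear_combination (Real.goldenRatio : ℂ) ^ 2 * h4
        - (zeta5 ^ 2 * (Real.goldenRatio + 1) + 1) * hg
    simp only [map_add, map_mul, map_one, map_pow, map_intCast, sigma_zetaGen]
    rw [e, intl, conj_eq, conj_eq]
    push_cast
    ring
  · simp only [map_add, map_mul, map_one, map_pow, map_intCast, kappa_zetaGen]
    rw [res, mod5_apply, mod5_apply]
    ring

theorem phys_eq_iff {x y : GoldenInt × GoldenInt} {t : ℝ} :
    (t : ℂ) * phys x = phys y ↔ t * toReal x.1 = toReal y.1 ∧ t * toReal x.2 = toReal y.2 := by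
  constructor
  · intro h
    have h1 := congrArg Complex.im h
    have h2 := congrArg Complex.re h
    simp only [phys, Complex.add_re, Complex.add_im, Complex.ofReal_re, Complex.ofReal_im,
      Complex.re_ofReal_mul, Complex.im_ofReal_mul, zero_add] at h1 h2
    have h3 : t * toReal x.2 = toReal y.2 := by
      rw [← mul_assoc] at h1
      exact mul_right_cancel₀ zeta5_im_pos.ne' h1
    refine ⟨?_, h3⟩
    linear_combination h2 - zeta5.re * h3
  · rintro ⟨h1, h2⟩
    rw [phys, phys, ← h1, ← h2]
    push_cast
    ring

theorem phys_injective : Function.Injective phys := fun x y h => by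
  have := phys_eq_iff (x := x) (y := y) (t := 1)
  rw [Complex.ofReal_one, one_mul, one_mul, one_mul] at this
  exact Prod.ext (toReal_injective (this.1 h).1) (toReal_injective (this.1 h).2)

/-- If `u x₁ + v x₂ = 1`, then `t = u y₁ + v y₂` lies in `ℤ[τ]`. -/
theorem IsPrimitive.exists_smul_eq {x y : GoldenInt × GoldenInt} (hx : IsPrimitive x) {t : ℝ}
    (h : (t : ℂ) * phys x = phys y) : ∃ c, toReal c = t ∧ y = c • x := by
  have h1 : (1 : GoldenInt) ∈ Ideal.span {x.1, x.2} := by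
    rw [hx, Ideal.one_eq_top]; trivial
  obtain ⟨u, v, huv⟩ := Ideal.mem_span_pair.1 h1
  obtain ⟨ha, hb⟩ := phys_eq_iff.1 h
  have hc : toReal (u * y.1 + v * y.2) = t := by
    have := congrArg toReal huv
    simp only [map_add, map_mul, map_one] at this ⊢
    rw [← ha, ← hb]
    linear_combination t * this
  refine ⟨_, hc, Prod.ext (toReal_injective ?_) (toReal_injective ?_)⟩
  · rw [← ha, Prod.smul_fst, smul_eq_mul, map_mul, hc]
  · rw [← hb, Prod.smul_snd, smul_eq_mul, map_mul, hc]

/-! ### The pentagon -/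

theorem pentagon_subset_closedBall : pentagon ⊆ Metric.closedBall 0 1 := by
  refine interior_subset.trans (convexHull_min ?_ (convex_closedBall 0 1))
  intro z hz
  simp only [Set.mem_insert_iff, Set.mem_singleton_iff] at hz
  rw [mem_closedBall_zero_iff]
  rcases hz with rfl | rfl | rfl | rfl | rfl <;> simp [norm_zeta5]

/-- A vector within the angle `arctan(3/4)` of an axis has at least `4/5` of its length along it.
This angle exceeds 36°, half the angle between adjacent vertices of the pentagon. -/
theorem le_of_abs_le {u v N : ℝ} (h : u ^ 2 + v ^ 2 = N ^ 2) (h1 : v ≤ 0.75 * u)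
    (h2 : -v ≤ 0.75 * u) : 0.8 * N ≤ u := by
  have hu : 0 ≤ u := by linarith
  refine le_of_pow_le_pow_left₀ two_ne_zero hu ?_
  linarith [mul_nonneg (sub_nonneg.2 h1) (sub_nonneg.2 h2)]

/-- The cones of half-angle `arctan(3/4)` about `1, ζ, ζ²` cover the upper half-plane, so the
direction `(X, Y)` falls into one of them. The identities `e1`, `e2` rotate the coordinates to the
axes `ζ` and `ζ²`. -/
theorem pentagon_support {X Y N : ℝ} (hY : 0 ≤ Y) (h : X ^ 2 + Y ^ 2 = N ^ 2)
    (h0 : X < 0.8 * N) (h1 : zeta5.re * X + zeta5.im * Y < 0.8 * N)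
    (h2 : (zeta5 ^ 2).re * X + (zeta5 ^ 2).im * Y < 0.8 * N) : False := by
  obtain ⟨hg, hg'⟩ := goldenRatio_bounds
  have hs := zeta5_im_sq
  have hg2 := Real.goldenRatio_sq
  have hs0 := zeta5_im_pos
  rw [zeta5_re] at h1
  rw [zeta5_sq_re, zeta5_sq_im] at h2
  set g := Real.goldenRatio
  set s := zeta5.im
  have hs1 : 0.951 < s := by
    refine lt_of_pow_lt_pow_left₀ 2 hs0.le ?_
    rw [hs]
    norm_num
    linarith
  have hs2 : s < 0.952 := by
    refine lt_of_pow_lt_pow_left₀ 2 (by norm_num) ?_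
    rw [hs]
    norm_num
    linarith
  have a0 : 0.75 * X < Y := by
    by_contra! hc
    have := le_of_abs_le h hc (by linarith)
    linarith
  have e1 : ((g - 1) / 2 * X + s * Y) ^ 2 + (-s * X + (g - 1) / 2 * Y) ^ 2 = N ^ 2 := by
    rw [← h]
    linear_combination (X ^ 2 + Y ^ 2) * hs + (1 / 4) * (X ^ 2 + Y ^ 2) * hg2
  have a1 : 0.75 * ((g - 1) / 2 * X + s * Y) < -s * X + (g - 1) / 2 * Y := by
    by_contra! hc
    have b1 : 0 ≤ s - 0.375 * (g - 1) := by linarith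
    have b2 : 0 ≤ (g - 1) - 0.5834 * s := by linarith
    have := le_of_abs_le e1 hc (by
      linarith [mul_nonneg b1 (sub_nonneg.2 a0.le), mul_nonneg hY b2, mul_nonneg hY hs0.le])
    linarith
  -- Lying beyond the cone about `ζ` puts the direction past about 108°, which leaves only the cone
  -- about `ζ²`.
  have hX : X ≤ -0.33 * Y := by
    by_contra! hc
    have b1 : 0 ≤ s + 0.375 * (g - 1) := by linarith
    have b2 : 0 ≤ 0.42 * s - 0.62375 * (g - 1) := by linarith
    linarith [mul_nonneg b1 (sub_nonneg.2 hc.le), mul_nonneg hY b2]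
  have e2 : (-g / 2 * X + (g - 1) * s * Y) ^ 2 + (-((g - 1) * s) * X + -g / 2 * Y) ^ 2 = N ^ 2 := by
    rw [← h]
    linear_combination (X ^ 2 + Y ^ 2) * ((g - 1) ^ 2) * hs
      + (1 / 4) * (X ^ 2 + Y ^ 2) * (g + 2) * hg2
  have hq1 : 0.587 < (g - 1) * s := by linarith [mul_pos (sub_pos.2 hg) hs0]
  have hq2 : (g - 1) * s < 0.589 := by linarith [mul_pos (sub_pos.2 hg') hs0]
  set q := (g - 1) * s
  have b1 : 0 ≤ 0.375 * g - q := by linarith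
  have b2 : 0 ≤ g / 2 + 0.75 * q + 0.33 * (0.375 * g - q) := by linarith
  have b3 : 0 ≤ q + 0.375 * g := by linarith
  have b4 : 0 ≤ 1.08 * q - 0.37625 * g := by linarith
  have := le_of_abs_le e2
    (by linarith [mul_nonneg b1 (sub_nonneg.2 hX), mul_nonneg hY b2])
    (by linarith [mul_nonneg b3 (sub_nonneg.2 hX), mul_nonneg hY b4])
  linarith

/-- A functional separating a point of the disc from the hull would be less than 0.8 times its norm
at all five vertices. The radius 0.8 is a rational bound below the inradius `cos 36°`. -/
theorem ball_subset_pentagon : Metric.ball 0 0.8 ⊆ pentagon := by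
  refine interior_maximal (fun z hz => ?_) Metric.isOpen_ball
  by_contra hzc
  set S : Set ℂ := {1, zeta5, zeta5 ^ 2, zeta5 ^ 3, zeta5 ^ 4} with hS
  have hclosed : IsClosed (convexHull ℝ S) := (Set.toFinite S).isClosed_convexHull ℝ
  obtain ⟨f, u, hf, hu⟩ := geometric_hahn_banach_closed_point (convex_convexHull ℝ S) hclosed hzc
  have hfz : ∀ w : ℂ, f w = f 1 * w.re + f Complex.I * w.im := fun w => by
    have hw : w = w.re • (1 : ℂ) + w.im • Complex.I := by
      rw [Complex.real_smul, Complex.real_smul, mul_one, Complex.re_add_im]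
    conv_lhs => rw [hw]
    rw [map_add, map_smul, map_smul, smul_eq_mul, smul_eq_mul, mul_comm, mul_comm w.im]
  set X := f 1
  set Y := f Complex.I
  set N := √(X ^ 2 + Y ^ 2)
  have hN : N ^ 2 = X ^ 2 + Y ^ 2 := Real.sq_sqrt (by positivity)
  have hN0 : 0 ≤ N := Real.sqrt_nonneg _
  have hz' : ‖z‖ < 0.8 := by simpa using hz
  have hfle : f z ≤ N * ‖z‖ := by
    rw [hfz]
    refine (le_abs_self _).trans (abs_le_of_sq_le_sq ?_ (mul_nonneg hN0 (norm_nonneg z)))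
    rw [mul_pow, hN, Complex.sq_norm, Complex.normSq_apply]
    linarith [sq_nonneg (X * z.im - Y * z.re)]
  have hlt : ∀ w ∈ S, X * w.re + Y * w.im < N * 0.8 := fun w hw => by
    have h1 := hf w (subset_convexHull ℝ S hw)
    rw [hfz] at h1
    linarith [mul_le_mul_of_nonneg_left hz'.le hN0]
  have hv0 := hlt 1 (by simp [hS])
  have hv1 := hlt zeta5 (by simp [hS])
  have hv2 := hlt (zeta5 ^ 2) (by simp [hS])
  have hv3 := hlt (zeta5 ^ 3) (by simp [hS])
  have hv4 := hlt (zeta5 ^ 4) (by simp [hS])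
  have hg2 := Real.goldenRatio_sq
  have r3 : (zeta5 ^ 3).re = (zeta5 ^ 2).re := by
    rw [zeta5_pow_three, ← Complex.ofReal_one, ← Complex.ofReal_sub, Complex.sub_re,
      Complex.re_ofReal_mul, zeta5_sq_re, zeta5_re]
    linear_combination (-1 / 2) * hg2
  have i3 : (zeta5 ^ 3).im = -(zeta5 ^ 2).im := by
    rw [zeta5_pow_three, ← Complex.ofReal_one, ← Complex.ofReal_sub, Complex.sub_im,
      Complex.im_ofReal_mul, zeta5_sq_im]
    linear_combination zeta5.im * hg2
  have r4 : (zeta5 ^ 4).re = zeta5.re := by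
    rw [zeta5_pow_four, ← Complex.ofReal_one, ← Complex.ofReal_neg, Complex.sub_re,
      Complex.re_ofReal_mul, zeta5_sq_re, zeta5_re, Complex.ofReal_re]
    linear_combination (1 / 2) * hg2
  have i4 : (zeta5 ^ 4).im = -zeta5.im := by
    rw [zeta5_pow_four, ← Complex.ofReal_one, ← Complex.ofReal_neg, Complex.sub_im,
      Complex.im_ofReal_mul, zeta5_sq_im, Complex.ofReal_im]
    linear_combination -zeta5.im * hg2
  rw [r3, i3] at hv3
  rw [r4, i4] at hv4
  rw [Complex.one_re, Complex.one_im] at hv0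
  rcases le_total 0 Y with hY | hY
  · exact pentagon_support (X := X) (Y := Y) (N := N) hY hN.symm (by linarith) (by linarith) (by linarith)
  · exact pentagon_support (X := X) (Y := -Y) (N := N) (neg_nonneg.2 hY) (by rw [neg_sq]; exact hN.symm) (by linarith)
      (by linarith) (by linarith)

end PenroseVisible

namespace PenroseVisible

open GoldenInt

/-! ### Windows -/

/-- The image of the pentagon under `w ↦ s w + a`. -/
def affineCopy (s : ℝ) (a : ℂ) : Set ℂ := (fun w : ℂ => (s : ℂ) * w + a) '' pentagon

theorem mem_affineCopy {s : ℝ} (hs : s ≠ 0) {a z : ℂ} :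
    z ∈ affineCopy s a ↔ (z - a) / s ∈ pentagon := by
  have hs' : (s : ℂ) ≠ 0 := by exact_mod_cast hs
  constructor
  · rintro ⟨w, hw, rfl⟩
    have : ((s : ℂ) * w + a - a) / s = w := by field_simp; ring
    rwa [this]
  · intro h
    exact ⟨_, h, by simp only; field_simp; ring⟩

theorem mem_affineCopy_of_norm_lt {s : ℝ} (hs : s ≠ 0) {a z : ℂ} (h : ‖z - a‖ < 0.8 * |s|) :
    z ∈ affineCopy s a := by
  rw [mem_affineCopy hs]
  apply ball_subset_pentagon
  rw [mem_ball_zero_iff, norm_div, Complex.norm_real, Real.norm_eq_abs,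
    div_lt_iff₀ (abs_pos.2 hs)]
  exact h

theorem norm_sub_le_of_mem_affineCopy {s : ℝ} {a z : ℂ} (h : z ∈ affineCopy s a) :
    ‖z - a‖ ≤ |s| := by
  obtain ⟨w, hw, rfl⟩ := h
  have := mem_closedBall_zero_iff.1 (pentagon_subset_closedBall hw)
  rw [add_sub_cancel_right, norm_mul, Complex.norm_real, Real.norm_eq_abs]
  exact mul_le_of_le_one_right (abs_nonneg _) this

theorem mul_mem_affineCopy {c s : ℝ} (hc : c ≠ 0) (hs : s ≠ 0) {a z : ℂ} :
    (c : ℂ) * z ∈ affineCopy s a ↔ z ∈ affineCopy (s / c) (a / c) := by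
  rw [mem_affineCopy hs, mem_affineCopy (div_ne_zero hs hc)]
  have hs' : (s : ℂ) ≠ 0 := by exact_mod_cast hs
  have hc' : (c : ℂ) ≠ 0 := by exact_mod_cast hc
  have : ((c : ℂ) * z - a) / s = (z - a / c) / ((s / c : ℝ) : ℂ) := by
    push_cast
    field_simp
  rw [this]

/-- The window of the residue class `k`. -/
def win (k : ZMod 5) (ε : ℂ) : Set ℂ := window k.val ε

theorem win_eq (k : ZMod 5) (ε : ℂ) : win k ε = affineCopy (windowScale k.val) ε := rfl

theorem abs_windowScale {k : ZMod 5} (hk : k ≠ 0) :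
    1 ≤ |windowScale k.val| ∧ |windowScale k.val| < 1.6181 := by
  obtain ⟨hg, hg'⟩ := goldenRatio_bounds
  have h : ∀ k : ZMod 5, k = 0 ∨ k.val = 1 ∨ k.val = 2 ∨ k.val = 3 ∨ k.val = 4 := by decide
  rcases (h k).resolve_left hk with h | h | h | h <;> rw [h] <;> simp only [windowScale]
  · norm_num
  · rw [abs_neg, abs_of_pos Real.goldenRatio_pos]; exact ⟨by linarith, hg'⟩
  · rw [abs_of_pos Real.goldenRatio_pos]; exact ⟨by linarith, hg'⟩
  · norm_num

theorem windowScale_ne_zero {k : ZMod 5} (hk : k ≠ 0) : windowScale k.val ≠ 0 := by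
  intro h
  have := (abs_windowScale hk).1
  rw [h, abs_zero] at this
  linarith

/-- The least scale is 1, and the shift costs less than 0.1: `0.8 - 0.1 = 0.7`. -/
theorem mem_win_of_norm_lt {k : ZMod 5} (hk : k ≠ 0) {ε z : ℂ} (hε : ‖ε‖ < 0.1) (hz : ‖z‖ < 0.7) :
    z ∈ win k ε := by
  refine mem_affineCopy_of_norm_lt (windowScale_ne_zero hk) ?_
  have := norm_sub_le z ε
  linarith [(abs_windowScale hk).1]

theorem norm_lt_of_mem_win {k : ZMod 5} (hk : k ≠ 0) {ε z : ℂ} (hε : ‖ε‖ < 0.1)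
    (hz : z ∈ win k ε) : ‖z‖ < 1.7181 := by
  have h1 := norm_sub_le_of_mem_affineCopy hz
  have h2 := norm_sub_norm_le z ε
  linarith [(abs_windowScale hk).2]

/-- The part of the window of the residue class `k` not hit after division by `τ` or `τ²`. -/
def visWin (k : ZMod 5) (ε : ℂ) : Set ℂ :=
  {z ∈ win k ε | ((-tau : ℝ) : ℂ) * z ∉ win (2 * k) ε ∧ ((tau ^ 2 : ℝ) : ℂ) * z ∉ win (4 * k) ε}

/-! ### Visible points are primitive points in the reduced windows -/

theorem penroseSet_eq (ε : ℂ) :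
    penroseSet ε = phys '' {x | res x ≠ 0 ∧ intl x ∈ win (res x) ε} := by
  have h0 : ∀ k ∈ Finset.Icc 1 4, ((k : ℕ) : ZMod 5) ≠ 0 ∧ ((k : ℕ) : ZMod 5).val = k := by decide
  have h1 : ∀ k : ZMod 5, k ≠ 0 → k.val ∈ Finset.Icc 1 4 := by decide
  ext z
  simp only [penroseSet, Set.mem_iUnion, lambdaSet]
  constructor
  · rintro ⟨k, hk, x, rfl, hx, hx'⟩
    obtain ⟨m, hm1, hm2, hm3⟩ := exists_phys_eq x
    refine ⟨m, ⟨?_, ?_⟩, hm1.symm⟩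
    · rw [← hm3, hx]; exact (h0 k hk).1
    · rw [← hm3, hx, win, (h0 k hk).2, ← hm2]; exact hx'
  · rintro ⟨m, ⟨hm, hm'⟩, rfl⟩
    obtain ⟨x, hx1, hx2, hx3⟩ := exists_eq_phys m
    refine ⟨(res m).val, h1 _ hm, x, hx1, ?_, ?_⟩
    · rw [hx3, ZMod.natCast_zmod_val]
    · rw [hx2]; exact hm'

/-- The form `a² + ab - b²` does not represent `±2` modulo 4 or `±3` modulo 9. -/
theorem four_le_abs_norm {d : GoldenInt} (h0 : d ≠ 0) (hu : ¬ IsUnit d) : 4 ≤ |d.norm| := by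
  have h1 : d.norm ≠ 0 := mt norm_eq_zero.1 h0
  have h2 : |d.norm| ≠ 1 := fun h =>
    hu (QuadraticAlgebra.isUnit_iff_norm_isUnit.2 (Int.isUnit_iff_abs_eq.2 h))
  have e4 : ∀ a b : ZMod 4, a * a + 1 * a * b - 1 * b * b ≠ 2 ∧
    a * a + 1 * a * b - 1 * b * b ≠ -2 := by decide
  have e9 : ∀ a b : ZMod 9, a * a + 1 * a * b - 1 * b * b ≠ 3 ∧
    a * a + 1 * a * b - 1 * b * b ≠ -3 := by decide
  have f4 := e4 d.re d.im
  have f9 := e9 d.re d.im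
  have h3 : d.norm ≠ 2 := fun h => f4.1 (by
    have := congrArg (Int.cast : ℤ → ZMod 4) h
    rw [QuadraticAlgebra.norm_def] at this
    push_cast at this ⊢
    exact this)
  have h4 : d.norm ≠ -2 := fun h => f4.2 (by
    have := congrArg (Int.cast : ℤ → ZMod 4) h
    rw [QuadraticAlgebra.norm_def] at this
    push_cast at this ⊢
    exact this)
  have h5 : d.norm ≠ 3 := fun h => f9.1 (by
    have := congrArg (Int.cast : ℤ → ZMod 9) h
    rw [QuadraticAlgebra.norm_def] at this
    push_cast at this ⊢
    exact this)
  have h6 : d.norm ≠ -3 := fun h => f9.2 (by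
    have := congrArg (Int.cast : ℤ → ZMod 9) h
    rw [QuadraticAlgebra.norm_def] at this
    push_cast at this ⊢
    exact this)
  have h7 : d.norm ≠ 1 := fun h => h2 (by rw [h]; rfl)
  have h8 : d.norm ≠ -1 := fun h => h2 (by rw [h]; rfl)
  rw [le_abs]
  omega

theorem phys_smul_mem_penroseSet {ε : ℂ} {c : GoldenInt} {x : GoldenInt × GoldenInt}
    (hr : mod5 c * res x ≠ 0) (hi : (conj c : ℂ) * intl x ∈ win (mod5 c * res x) ε) :
    (toReal c : ℂ) * phys x ∈ penroseSet ε := by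
  rw [penroseSet_eq]
  refine ⟨c • x, ⟨?_, ?_⟩, phys_smul c x⟩
  · rwa [res_smul]
  · rwa [res_smul, intl_smul]

/-- Suppose `x = d y` with `d > 0` a nonunit. If `τⁿ < d ≤ τⁿ⁺¹`, then `τⁿ y` precedes `x` on its
ray, and `|σ(τⁿ y)| ≤ 1.7181 τ / |N(d)|`. With `|N(d)| ≥ 4` this is below 0.7, so `τⁿ y` lies in
`𝒫_ε` whatever its nonzero residue. -/
theorem isPrimitive_of_phys_mem_visible {ε : ℂ} (hε : ‖ε‖ < 0.1) {x : GoldenInt × GoldenInt}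
    (hr : res x ≠ 0) (hi : intl x ∈ win (res x) ε) (hx : phys x ∈ visible (penroseSet ε)) :
    IsPrimitive x := by
  have : Fact (Nat.Prime 5) := ⟨Nat.prime_five⟩
  obtain ⟨d₀, hd₀⟩ := exists_generator (Ideal.span {x.1, x.2})
  obtain ⟨d, hd, hdpos⟩ : ∃ d, Ideal.span {x.1, x.2} = Ideal.span {d} ∧ 0 ≤ toReal d := by
    rcases le_total 0 (toReal d₀) with h | h
    · exact ⟨d₀, hd₀, h⟩
    · exact ⟨-d₀, by rw [Ideal.span_singleton_neg]; exact hd₀, by rw [map_neg]; linarith⟩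
  obtain ⟨y, hy⟩ := (span_singleton_dvd_iff d x).1 (by rw [hd])
  rw [hy, res_smul] at hr
  have hd0 : d ≠ 0 := by rintro rfl; simp at hr
  rw [IsPrimitive, hd, Ideal.one_eq_top, Ideal.span_singleton_eq_top]
  by_contra hu
  have hpos : 0 < toReal d := hdpos.lt_of_ne' ((map_ne_zero_iff _ toReal_injective).2 hd0)
  obtain ⟨n, hn, hn'⟩ := exists_mem_Ioc_zpow hpos Real.one_lt_goldenRatio
  have hgn : 0 < Real.goldenRatio ^ n := zpow_pos Real.goldenRatio_pos n
  rw [zpow_add_one₀ Real.goldenRatio_ne_zero] at hn'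
  have hN : (4 : ℝ) ≤ toReal d * |conj d| := by
    rw [← abs_of_pos hpos, ← abs_mul, toReal_mul_conj]
    exact_mod_cast four_le_abs_norm hd0 hu
  set c : GoldenInt := ((tauUnit ^ n : GoldenIntˣ) : GoldenInt)
  have hc : mod5 c * res y ≠ 0 :=
    mul_ne_zero ((tauUnit ^ n).isUnit.map mod5).ne_zero (right_ne_zero_of_mul hr)
  refine hx.2 (Real.goldenRatio ^ n / toReal d) (by positivity) ((div_lt_one hpos).2 hn) ?_
  have hxy : ((Real.goldenRatio ^ n / toReal d : ℝ) : ℂ) * phys x = (toReal c : ℂ) * phys y := by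
    have h1 : (toReal d : ℂ) ≠ 0 := by exact_mod_cast hpos.ne'
    rw [toReal_tauUnit_zpow, hy, phys_smul, Complex.ofReal_div]
    field_simp
  rw [hxy]
  refine phys_smul_mem_penroseSet hc (mem_win_of_norm_lt hc hε ?_)
  rw [norm_mul, Complex.norm_real, Real.norm_eq_abs, abs_conj_tauUnit_zpow, inv_mul_lt_iff₀ hgn]
  have h2 := norm_lt_of_mem_win (by rwa [← res_smul, ← hy] at hr) hε hi
  rw [hy, intl_smul, norm_mul, Complex.norm_real, Real.norm_eq_abs] at h2
  have hg := goldenRatio_bounds.2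
  have h3 : 4 * ‖intl y‖ ≤ toReal d * (|conj d| * ‖intl y‖) := by
    rw [← mul_assoc]
    exact mul_le_mul_of_nonneg_right hN (norm_nonneg _)
  have h4 : toReal d * (|conj d| * ‖intl y‖) ≤ Real.goldenRatio ^ n * Real.goldenRatio * 1.7181 :=
    mul_le_mul hn' h2.le (by positivity) (by positivity)
  have h5 := mul_lt_mul_of_pos_left hg hgn
  linarith

/-- The pairs `⟨-1, 1⟩` and `⟨2, -1⟩` are `1/τ` and `1/τ²`, with conjugates `-τ` and `τ²` and
residues 2 and 4; these are the factors in `visWin`. -/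
theorem visible_penroseSet {ε : ℂ} (hε : ‖ε‖ < 0.1) :
    visible (penroseSet ε)
      = phys '' {x | IsPrimitive x ∧ res x ≠ 0 ∧ intl x ∈ visWin (res x) ε} := by
  obtain ⟨hg, hg'⟩ := goldenRatio_bounds
  have r1 : toReal ⟨-1, 1⟩ = tau - 1 := by rw [toReal_apply]; push_cast; ring
  have i1 : conj ⟨-1, 1⟩ = -tau := by rw [conj_eq]; push_cast; ring
  have m1 : mod5 ⟨-1, 1⟩ = 2 := by rw [mod5_apply]; decide
  have r2 : toReal ⟨2, -1⟩ = 2 - tau := by rw [toReal_apply]; push_cast; ring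
  have i2 : conj ⟨2, -1⟩ = tau ^ 2 := by rw [conj_eq, Real.goldenRatio_sq]; push_cast; ring
  have m2 : mod5 ⟨2, -1⟩ = 4 := by rw [mod5_apply]; decide
  have e2 : (2 : ZMod 5) ≠ 0 := by decide
  have e4 : (4 : ZMod 5) ≠ 0 := by decide
  have : Fact (Nat.Prime 5) := ⟨Nat.prime_five⟩
  ext z
  constructor
  · intro hz
    have hz1 := hz.1
    rw [penroseSet_eq] at hz1
    obtain ⟨x, ⟨hr, hi⟩, rfl⟩ := hz1
    refine ⟨x, ⟨isPrimitive_of_phys_mem_visible hε hr hi hz, hr, hi, fun h => ?_, fun h => ?_⟩, rfl⟩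
    · refine hz.2 (tau - 1) (by linarith) (by linarith) ?_
      rw [← r1]
      refine phys_smul_mem_penroseSet ?_ ?_
      · rw [m1]; exact mul_ne_zero e2 hr
      · rw [m1, i1]; exact h
    · refine hz.2 (2 - tau) (by linarith) (by linarith) ?_
      rw [← r2]
      refine phys_smul_mem_penroseSet ?_ ?_
      · rw [m2]; exact mul_ne_zero e4 hr
      · rw [m2, i2]; exact h
  · rintro ⟨x, ⟨hp, hr, hi, hi2, hi4⟩, rfl⟩
    refine ⟨by rw [penroseSet_eq]; exact ⟨x, ⟨hr, hi⟩, rfl⟩, fun t ht0 ht1 hmem => ?_⟩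
    rw [penroseSet_eq] at hmem
    obtain ⟨y, ⟨hyr, hyi⟩, hy⟩ := hmem
    obtain ⟨c, rfl, rfl⟩ := hp.exists_smul_eq hy.symm
    rw [res_smul, intl_smul] at hyi
    rw [res_smul] at hyr
    rcases eq_or_le_abs_conj ht0 ht1 with rfl | rfl | h
    · rw [m1, i1] at hyi; exact hi2 hyi
    · rw [m2, i2] at hyi; exact hi4 hyi
    -- Here `|σ(x)| < 1.7181/4.236`, so `τ|σ(x)| < 0.7` and `x/τ` would already lie in `𝒫_ε`.
    · refine hi2 (mem_win_of_norm_lt (mul_ne_zero e2 hr) hε ?_)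
      have h1 := norm_lt_of_mem_win hyr hε hyi
      rw [norm_mul, Complex.norm_real, Real.norm_eq_abs] at h1 ⊢
      rw [abs_neg, abs_of_pos Real.goldenRatio_pos]
      have h2 := mul_le_mul_of_nonneg_right h (norm_nonneg (intl x))
      have h3 := mul_le_mul_of_nonneg_right hg'.le (norm_nonneg (intl x))
      linarith

end PenroseVisible

namespace PenroseVisible

/-! ### Jordan measurability of the windows -/

namespace JordanMeasurable

variable {A B : Set ℂ}

theorem union (hA : JordanMeasurable A) (hB : JordanMeasurable B) : JordanMeasurable (A ∪ B) :=
  ⟨hA.1.union hB.1, measure_mono_null ((frontier_union_subset A B).trans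
    (Set.union_subset_union Set.inter_subset_left Set.inter_subset_right))
    (measure_union_null hA.2 hB.2)⟩

theorem diff (hA : JordanMeasurable A) (hB : JordanMeasurable B) : JordanMeasurable (A \ B) := by
  refine ⟨hA.1.subset Set.sdiff_subset, measure_mono_null ?_ (measure_union_null hA.2 hB.2)⟩
  rw [Set.sdiff_eq, ← frontier_compl B]
  exact (frontier_inter_subset A Bᶜ).trans
    (Set.union_subset_union Set.inter_subset_left Set.inter_subset_right)

theorem measureReal_smul (T : ℝ) (D : Set ℂ) :
    volume.real (T • D) = T ^ 2 * volume.real D := by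
  rw [measureReal_def, Measure.addHaar_smul, Complex.finrank_real_complex, ENNReal.toReal_mul,
    ENNReal.toReal_ofReal (abs_nonneg _), abs_of_nonneg (sq_nonneg T), measureReal_def]

end JordanMeasurable

theorem isOpen_affineCopy {s : ℝ} (hs : s ≠ 0) (a : ℂ) : IsOpen (affineCopy s a) := by
  have : affineCopy s a = (fun z => (z - a) / s) ⁻¹' pentagon := by
    ext z; exact mem_affineCopy hs
  rw [this]
  exact isOpen_interior.preimage (by fun_prop)

theorem jordanMeasurable_affineCopy (s : ℝ) (a : ℂ) : JordanMeasurable (affineCopy s a) := by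
  constructor
  · refine Metric.isBounded_closedBall (x := a) (r := |s|) |>.subset fun z hz => ?_
    rw [mem_closedBall_iff_norm]
    exact norm_sub_le_of_mem_affineCopy hz
  · have h : affineCopy s a = (fun w => a + s • w) '' pentagon := by
      simp only [affineCopy, Complex.real_smul, add_comm]
    rw [h]
    exact ((convex_convexHull ℝ _).interior.affinity a s).addHaar_frontier volume

theorem visWin_eq {k : ZMod 5} (hk : k ≠ 0) (ε : ℂ) : visWin k ε = win k ε \
    (affineCopy (windowScale (2 * k).val / -tau) (ε / (-tau : ℝ)) ∪
      affineCopy (windowScale (4 * k).val / tau ^ 2) (ε / (tau ^ 2 : ℝ))) := by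
  have h2 : ∀ k : ZMod 5, k ≠ 0 → 2 * k ≠ 0 ∧ 4 * k ≠ 0 := by decide
  have hg := Real.goldenRatio_ne_zero
  ext z
  rw [Set.mem_sdiff, Set.mem_union, not_or,
    ← mul_mem_affineCopy (neg_ne_zero.2 hg) (windowScale_ne_zero (h2 k hk).1),
    ← mul_mem_affineCopy (pow_ne_zero 2 hg) (windowScale_ne_zero (h2 k hk).2)]
  rfl

theorem jordanMeasurable_visWin {k : ZMod 5} (hk : k ≠ 0) (ε : ℂ) :
    JordanMeasurable (visWin k ε) := by
  rw [visWin_eq hk]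
  exact (jordanMeasurable_affineCopy _ _).diff
    ((jordanMeasurable_affineCopy _ _).union (jordanMeasurable_affineCopy _ _))

/-! ### Areas of the reduced windows -/

/-- The area of the overlap of the pentagon with its translate by `c`. -/
def overlap (c : ℂ) : ℝ := volume.real (pentagon ∩ (fun w : ℂ => w + c) '' pentagon)

theorem measureReal_affine_image (s : ℝ) (a : ℂ) (E : Set ℂ) :
    volume.real ((fun w : ℂ => (s : ℂ) * w + a) '' E) = s ^ 2 * volume.real E := by
  rw [← JordanMeasurable.measureReal_smul, measureReal_def, measureReal_def]
  have : (fun w : ℂ => (s : ℂ) * w + a) '' E = (fun w => w + -a) ⁻¹' (s • E) := by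
    rw [← Set.image_add_right, ← Set.image_smul, Set.image_image]
    rfl
  rw [this, measure_preimage_add_right]

theorem measureReal_affineCopy (s : ℝ) (a : ℂ) :
    volume.real (affineCopy s a) = s ^ 2 * volume.real pentagon :=
  measureReal_affine_image s a pentagon

theorem measureReal_affineCopy_inter {s : ℝ} (hs : s ≠ 0) (a b : ℂ) :
    volume.real (affineCopy s a ∩ affineCopy s b) = s ^ 2 * overlap ((b - a) / s) := by
  have hs' : (s : ℂ) ≠ 0 := by exact_mod_cast hs
  have hinj : Function.Injective fun w : ℂ => (s : ℂ) * w + a := fun v w h => by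
    simpa [hs] using h
  have h : affineCopy s b =
      (fun w : ℂ => (s : ℂ) * w + a) '' ((fun w => w + (b - a) / s) '' pentagon) := by
    rw [affineCopy, Set.image_image]
    congr 1
    funext w
    field_simp
    ring
  rw [overlap, ← measureReal_affine_image s a, Set.image_inter hinj, ← h, affineCopy]

theorem overlap_neg (c : ℂ) : overlap (-c) = overlap c := by
  have h1 : affineCopy 1 0 ∩ affineCopy 1 c = affineCopy 1 c ∩ affineCopy 1 0 := Set.inter_comm _ _
  have h2 := congrArg volume.real h1
  rw [measureReal_affineCopy_inter one_ne_zero, measureReal_affineCopy_inter one_ne_zero] at h2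
  simpa using h2.symm

theorem goldenRatio_inv_add_sq_inv : (tau : ℝ)⁻¹ + (tau ^ 2)⁻¹ = 1 := by
  rw [← inv_pow, Real.inv_goldenRatio, neg_sq, Real.goldenConj_sq]
  ring

/-- The classes `k = 1, 4`. The copy removed on account of `1/τ²` lies inside the one removed on
account of `1/τ`, and the latter is the window itself translated by `-ε/τ - ε = -τε`. -/
theorem measureReal_visWin_of_abs_eq_one {k : ZMod 5} (hk : k ≠ 0) {ε : ℂ} (hε : ‖ε‖ < 0.1) {s : ℝ}
    (hs : s ^ 2 = 1) (h1 : windowScale k.val = s) (h2 : windowScale (2 * k).val = s * -tau)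
    (h4 : windowScale (4 * k).val = -s) :
    volume.real (visWin k ε) = volume.real pentagon - overlap (tau * ε) := by
  obtain ⟨hg, hg'⟩ := goldenRatio_bounds
  have hk2 : ∀ k : ZMod 5, k ≠ 0 → 2 * k ≠ 0 := by decide
  have hg0 := Real.goldenRatio_ne_zero
  have hs0 : s ≠ 0 := by rintro rfl; norm_num at hs
  have hsub : affineCopy (windowScale (4 * k).val / tau ^ 2) (ε / (tau ^ 2 : ℝ)) ⊆
      affineCopy (windowScale (2 * k).val / -tau) (ε / (-tau : ℝ)) := by
    intro z hz
    rw [← mul_mem_affineCopy (pow_ne_zero 2 hg0) (by rw [h4]; exact neg_ne_zero.2 hs0)] at hz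
    rw [← mul_mem_affineCopy (neg_ne_zero.2 hg0) (windowScale_ne_zero (hk2 k hk))]
    refine mem_win_of_norm_lt (hk2 k hk) hε ?_
    have h5 := norm_sub_le_of_mem_affineCopy hz
    have h6 := norm_sub_norm_le (((tau ^ 2 : ℝ) : ℂ) * z) ε
    have h7 : |windowScale (4 * k).val| = 1 := by
      rw [h4, abs_neg, ← Real.sqrt_sq_eq_abs, hs, Real.sqrt_one]
    rw [h7] at h5
    rw [norm_mul, Complex.norm_real, Real.norm_eq_abs] at h6 ⊢
    rw [abs_of_nonneg (sq_nonneg _)] at h6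
    rw [abs_neg, abs_of_pos Real.goldenRatio_pos]
    have h8 : tau ^ 2 * ‖z‖ = tau * (tau * ‖z‖) := by ring
    have h9 : 1.618 * (tau * ‖z‖) ≤ tau * (tau * ‖z‖) := by gcongr
    linarith
  have hA : affineCopy (windowScale (2 * k).val / -tau) (ε / (-tau : ℝ)) =
      affineCopy s (ε / (-tau : ℝ)) := by rw [h2, mul_div_cancel_right₀ _ (neg_ne_zero.2 hg0)]
  have hc : (ε / ((-tau : ℝ) : ℂ) - ε) = -(tau * ε) := by
    have h := congrArg (Complex.ofReal) Real.goldenRatio_sq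
    rw [Complex.ofReal_pow, Complex.ofReal_add, Complex.ofReal_one] at h
    have hgc : (tau : ℂ) ≠ 0 := by exact_mod_cast hg0
    rw [Complex.ofReal_neg]
    field_simp
    linear_combination ε * h
  have hov : overlap (-(tau * ε) / s) = overlap (tau * ε) := by
    rcases eq_or_eq_neg_of_sq_eq_sq s 1 (by rw [hs, one_pow]) with rfl | rfl
    · rw [Complex.ofReal_one, div_one, overlap_neg]
    · rw [Complex.ofReal_neg, Complex.ofReal_one, neg_div_neg_eq, div_one]
  rw [visWin_eq hk, Set.union_eq_self_of_subset_right hsub, hA, win_eq, h1]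
  have h10 := measureReal_inter_add_sdiff (μ := volume) (s := affineCopy s ε)
    (isOpen_affineCopy hs0 (ε / (-tau : ℝ))).measurableSet
    (jordanMeasurable_affineCopy s ε).1.measure_lt_top.ne
  rw [measureReal_affineCopy_inter hs0, measureReal_affineCopy, hs, hc, hov] at h10
  linarith

/-- The classes `k = 2, 3`. Both removed copies are pentagons of scale `±1/τ` inside the window,
with centres differing by `ε/τ² + ε/τ = ε`; in units of the scale this is `±τε`. Inclusion-exclusion
gives the area of their union. -/
theorem measureReal_visWin_of_abs_eq_goldenRatio {k : ZMod 5} (hk : k ≠ 0) {ε : ℂ}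
    (hε : ‖ε‖ < 0.1) {s : ℝ}
    (hs : s ^ 2 = 1) (h1 : windowScale k.val = -s * tau) (h2 : windowScale (2 * k).val = -s)
    (h4 : windowScale (4 * k).val = s * tau) :
    volume.real (visWin k ε) = tau ^ 2 * volume.real pentagon -
      (tau ^ 2)⁻¹ * (2 * volume.real pentagon - overlap (tau * ε)) := by
  obtain ⟨hg, hg'⟩ := goldenRatio_bounds
  have hk2 : ∀ k : ZMod 5, k ≠ 0 → 2 * k ≠ 0 ∧ 4 * k ≠ 0 := by decide
  have hg0 := Real.goldenRatio_ne_zero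
  have hs0 : s ≠ 0 := by rintro rfl; norm_num at hs
  have hA : affineCopy (windowScale (2 * k).val / -tau) (ε / (-tau : ℝ)) =
      affineCopy (s / tau) (ε / (-tau : ℝ)) := by rw [h2, neg_div_neg_eq]
  have hB : affineCopy (windowScale (4 * k).val / tau ^ 2) (ε / (tau ^ 2 : ℝ)) =
      affineCopy (s / tau) (ε / (tau ^ 2 : ℝ)) := by
    rw [h4]; congr 1; field_simp
  have hsA : affineCopy (s / tau) (ε / (-tau : ℝ)) ⊆ win k ε := by
    intro z hz
    rw [← hA, ← mul_mem_affineCopy (neg_ne_zero.2 hg0) (windowScale_ne_zero (hk2 k hk).1)] at hz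
    refine mem_win_of_norm_lt hk hε ?_
    have h5 := norm_sub_le_of_mem_affineCopy hz
    have h6 := norm_sub_norm_le (((-tau : ℝ) : ℂ) * z) ε
    have h7 : |windowScale (2 * k).val| = 1 := by
      rw [h2, abs_neg, ← Real.sqrt_sq_eq_abs, hs, Real.sqrt_one]
    rw [h7] at h5
    rw [norm_mul, Complex.norm_real, Real.norm_eq_abs, abs_neg,
      abs_of_pos Real.goldenRatio_pos] at h6
    have h9 : 1.618 * ‖z‖ ≤ tau * ‖z‖ := by gcongr
    linarith
  have hsB : affineCopy (s / tau) (ε / (tau ^ 2 : ℝ)) ⊆ win k ε := by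
    intro z hz
    rw [← hB, ← mul_mem_affineCopy (pow_ne_zero 2 hg0) (windowScale_ne_zero (hk2 k hk).2)] at hz
    refine mem_win_of_norm_lt hk hε ?_
    have h5 := norm_lt_of_mem_win (hk2 k hk).2 hε hz
    rw [norm_mul, Complex.norm_real, Real.norm_eq_abs, abs_of_nonneg (sq_nonneg _),
      Real.goldenRatio_sq] at h5
    have h9 : 2.618 * ‖z‖ ≤ (tau + 1) * ‖z‖ := by gcongr; linarith
    linarith
  have hc : ((ε / ((tau ^ 2 : ℝ) : ℂ) - ε / ((-tau : ℝ) : ℂ)) / ((s / tau : ℝ) : ℂ))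
      = (tau * ε) / s := by
    have h := congrArg (Complex.ofReal) goldenRatio_inv_add_sq_inv
    revert h
    generalize (tau : ℝ) = g
    intro h
    rw [Complex.ofReal_add, Complex.ofReal_one, Complex.ofReal_inv, Complex.ofReal_inv] at h
    rw [Complex.ofReal_neg, Complex.ofReal_div, div_neg, sub_neg_eq_add, div_div_eq_mul_div,
      div_eq_mul_inv ε, div_eq_mul_inv ε, ← mul_add, add_comm, h, mul_one, mul_comm]
  have hov : overlap (tau * ε / s) = overlap (tau * ε) := by
    rcases eq_or_eq_neg_of_sq_eq_sq s 1 (by rw [hs, one_pow]) with rfl | rfl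
    · rw [Complex.ofReal_one, div_one]
    · rw [Complex.ofReal_neg, Complex.ofReal_one, div_neg, div_one, overlap_neg]
  have hst : s / tau ≠ 0 := div_ne_zero hs0 hg0
  have hst2 : (s / tau) ^ 2 = (tau ^ 2)⁻¹ := by rw [div_pow, hs, one_div]
  have hfin : ∀ r a, volume (affineCopy r a) ≠ ⊤ := fun r a =>
    (jordanMeasurable_affineCopy r a).1.measure_lt_top.ne
  have hm : ∀ a, MeasurableSet (affineCopy (s / tau) a) := fun a =>
    (isOpen_affineCopy hst a).measurableSet
  rw [visWin_eq hk, hA, hB, measureReal_sdiff (Set.union_subset hsA hsB) ((hm _).union (hm _))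
    (hfin _ _), win_eq, h1, measureReal_affineCopy]
  have h10 := measureReal_union_add_inter (μ := volume)
    (s := affineCopy (s / tau) (ε / (-tau : ℝ))) (hm (ε / (tau ^ 2 : ℝ)))
    (hfin _ _) (hfin _ _)
  rw [measureReal_affineCopy_inter hst, measureReal_affineCopy, measureReal_affineCopy, hc, hov,
    hst2] at h10
  rw [mul_pow, neg_sq, hs, one_mul]
  linarith

theorem sum_measureReal_visWin {ε : ℂ} (hε : ‖ε‖ < 0.1) :
    ∑ k ∈ Finset.univ.erase (0 : ZMod 5), volume.real (visWin k ε) =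
      2 * tau⁻¹ * ((3 + tau) * volume.real pentagon - overlap (tau * ε)) := by
  have hsum : Finset.univ.erase (0 : ZMod 5) = {1, 2, 3, 4} := by decide
  rw [hsum, Finset.sum_insert (by decide), Finset.sum_insert (by decide),
    Finset.sum_insert (by decide), Finset.sum_singleton,
    measureReal_visWin_of_abs_eq_one (k := 1) (s := 1) (by decide) hε (by norm_num) rfl
      (by rw [one_mul]; rfl) rfl,
    measureReal_visWin_of_abs_eq_one (k := 4) (s := -1) (by decide) hε (by norm_num) rfl
      (by rw [neg_mul_neg, one_mul]; rfl) (by rw [neg_neg]; rfl),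
    measureReal_visWin_of_abs_eq_goldenRatio (k := 2) (s := 1) (by decide) hε (by norm_num)
      (by rw [neg_mul, one_mul]; rfl) rfl (by rw [one_mul]; rfl),
    measureReal_visWin_of_abs_eq_goldenRatio (k := 3) (s := -1) (by decide) hε (by norm_num)
      (by rw [neg_neg, one_mul]; rfl) (by rw [neg_neg]; rfl) (by rw [neg_mul, one_mul]; rfl)]
  have h1 := goldenRatio_inv_add_sq_inv
  have h2 : (tau ^ 2)⁻¹ = 1 - (tau : ℝ)⁻¹ := by linarith
  have h3 : (tau : ℝ)⁻¹ = tau - 1 := by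
    rw [Real.inv_goldenRatio]; linarith [Real.goldenRatio_add_goldenConj]
  rw [h2, Real.goldenRatio_sq, h3]
  have h4 : tau * tau = tau + 1 := by rw [← sq, Real.goldenRatio_sq]
  linear_combination (-2 * volume.real pentagon) * h4

end PenroseVisible

namespace PenroseVisible

/-! ### The density of the visible points -/

/-- Splitting by residue gives a disjoint union over the nonzero classes, so counts and densities
add. -/
theorem visible_inter_smul {ε : ℂ} (hε : ‖ε‖ < 0.1) (D : Set ℂ) (T : ℝ) :
    visible (penroseSet ε) ∩ T • D = phys '' ⋃ k ∈ (Finset.univ.erase (0 : ZMod 5) : Set (ZMod 5)),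
      {x ∈ region k D (visWin k ε) T | IsPrimitive x} := by
  rw [visible_penroseSet hε]
  ext z
  constructor
  · rintro ⟨⟨x, ⟨hp, hr, hi⟩, rfl⟩, hD⟩
    refine ⟨x, ?_, rfl⟩
    simp only [Set.mem_iUnion]
    exact ⟨res x, by simpa using hr, ⟨rfl, hD, hi⟩, hp⟩
  · rintro ⟨x, hx, rfl⟩
    simp only [Set.mem_iUnion] at hx
    obtain ⟨k, hk, ⟨rfl, hD, hi⟩, hp⟩ := hx
    exact ⟨⟨x, ⟨hp, by simpa using hk, hi⟩, rfl⟩, hD⟩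

theorem finite_primitive_region {k : ZMod 5} (hk : k ≠ 0) (ε : ℂ) {D : Set ℂ}
    (hD : Bornology.IsBounded D) {T : ℝ} (hT : 0 < T) :
    {x ∈ region k D (visWin k ε) T | IsPrimitive x}.Finite :=
  (finite_region hk hD (jordanMeasurable_visWin hk ε).1 hT).subset (Set.sep_subset _ _)

theorem ncard_visible_inter_smul {ε : ℂ} (hε : ‖ε‖ < 0.1) {D : Set ℂ} (hD : Bornology.IsBounded D)
    {T : ℝ} (hT : 0 < T) :
    (visible (penroseSet ε) ∩ T • D).ncard = ∑ k ∈ Finset.univ.erase (0 : ZMod 5),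
      {x ∈ region k D (visWin k ε) T | IsPrimitive x}.ncard := by
  rw [visible_inter_smul hε, Set.ncard_image_of_injective _ phys_injective,
    (Finset.finite_toSet _).ncard_biUnion, finsum_mem_coe_finset]
  · exact fun k hk => finite_primitive_region (by simpa using hk) ε hD hT
  · exact fun k _ l _ hkl => Set.disjoint_left.2 fun x hx hy => hkl (hx.1.1.symm.trans hy.1.1)

theorem locFinite_visible {ε : ℂ} (hε : ‖ε‖ < 0.1) : LocFinite (visible (penroseSet ε)) := by
  intro B hB
  have h := visible_inter_smul hε B 1
  rw [one_smul] at h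
  rw [h]
  refine ((Finset.finite_toSet _).biUnion fun k hk => ?_).image _
  exact finite_primitive_region (by simpa using hk) ε hB one_pos

theorem hasDensity_visible {ε : ℂ} (hε : ‖ε‖ < 0.1) :
    HasDensity (visible (penroseSet ε))
      (∑ k ∈ Finset.univ.erase (0 : ZMod 5),
        volume.real (visWin k ε) * (1 / (6 * √5)) / ∑' I, GoldenInt.normInvSq I) := by
  refine ⟨locFinite_visible hε, fun D hD hD0 => ?_⟩
  have hV : 0 < volume.real D := ENNReal.toReal_pos hD0.ne' hD.1.measure_lt_top.ne
  have h := tendsto_finsetSum (Finset.univ.erase (0 : ZMod 5)) fun k hk =>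
    (tendsto_ncard_primitive (Finset.ne_of_mem_erase hk) hD
      (jordanMeasurable_visWin (Finset.ne_of_mem_erase hk) ε)).div_const (volume.real D)
  convert h.congr' ?_ using 2
  · refine Finset.sum_congr rfl fun k _ => ?_
    rw [← measureReal_def, ← measureReal_def]
    field_simp
  · filter_upwards [eventually_gt_atTop 0] with T hT
    rw [← measureReal_def, JordanMeasurable.measureReal_smul, ncard_visible_inter_smul hε hD.1 hT,
      Nat.cast_sum, Finset.sum_div]
    exact Finset.sum_congr rfl fun k _ => div_div _ _ _

theorem density_eq {ε : ℂ} (hε : ‖ε‖ < 0.1) (Z : ℝ) :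
    ∑ k ∈ Finset.univ.erase (0 : ZMod 5), volume.real (visWin k ε) * (1 / (6 * √5)) / Z =
      ((3 + tau) * volume.real pentagon - overlap (tau * ε)) / (3 * (tau + 2) * Z) := by
  rw [← Finset.sum_div, ← Finset.sum_mul, sum_measureReal_visWin hε]
  have h : tau * √5 = tau + 2 := by
    have h5 : √5 * √5 = 5 := Real.mul_self_sqrt (by norm_num)
    rw [tau, Real.goldenRatio]
    linear_combination h5 / 2
  have h5 : (√5 : ℝ) ≠ 0 := by positivity
  have hg := Real.goldenRatio_ne_zero
  rw [← h]
  generalize (3 + tau) * volume.real pentagon - overlap (tau * ε) = N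
  revert hg
  generalize (tau : ℝ) = g
  intro hg
  -- For `Z = 0` both sides are 0 by the convention for division.
  rcases eq_or_ne Z 0 with rfl | hZ
  · simp
  · field_simp
    ring

end PenroseVisible

end

theorem mainTheorem4 (ε : ℂ) (hε : ‖ε‖ < 0.1) :
    ∃ θ : ℝ,
      PenroseVisible.HasDensity (PenroseVisible.visible (PenroseVisible.penroseSet ε)) θ ∧
      (θ : ℂ) =
        (((3 + PenroseVisible.tau) * (volume PenroseVisible.pentagon).toReal -
            (volume (PenroseVisible.pentagon ∩
              (fun w : ℂ => w + (PenroseVisible.tau : ℂ) * ε) ''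
                PenroseVisible.pentagon)).toReal : ℝ) : ℂ) /
          (3 * ((PenroseVisible.tau : ℂ) + 2) *
            NumberField.dedekindZeta PenroseVisible.QSqrtFive 2) := by
  refine ⟨_, PenroseVisible.hasDensity_visible hε, ?_⟩
  rw [PenroseVisible.density_eq hε, PenroseVisible.GoldenInt.dedekindZeta_two_eq,
    PenroseVisible.overlap, measureReal_def, measureReal_def, Complex.ofReal_div, Complex.ofReal_mul,
    Complex.ofReal_mul, Complex.ofReal_add, Complex.ofReal_ofNat, Complex.ofReal_ofNat]
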